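/- Let $c=(c_{i,j})_{i,j\ge 0}$ be a symmetric semi-infinite complex matrix, let $\Lambda=(\delta_{i+1,j})_{i,j\ge0}$ be the shift matrix, and let $t=(t_1,t_2,\dots)$, $s=(s_1,s_2,\dots)$ be formal variables. Put $$m(t,s)=e^{\sum_{k\ge1}t_k\Lambda^k}\,c\,e^{-\sum_{k\ge1}s_k(\Lambda^{\top})^k},\qquad \tau_m(t,s)=\det\big(m_{i,j}(t,s)\big)_{i,j=0}^{m-1},\qquad \tilde\tau_m(t)=\tau_m(t,-t),$$ with $\tau_0=1$; the entries of $m(t,s)$, and hence $\tau_m$ and $\tilde\tau_m$, are formal power series in the times. Write $[z]=(z,z^2/2,z^3/3,\dots)$ and $\tilde\partial_t=(\partial_{t_1},\tfrac12\partial_{t_2},\tfrac13\partial_{t_3},\dots)$, and let $p_n$ be the elementary Schur polynomials, $\sum_{n\ge0}p_n(x)z^n=\exp\big(\sum_{k\ge1}x_kz^k\big)$, with $p_n=0$ for $n<0$. In expressions $\cdots\tau_m(t,s)|_{s=-t}$ the $t$-derivatives are taken first, with $s$ independent of $t$, and then $s=-t$ is imposed. (1) For every $m\ge1$, as formal power series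 in $t,\alpha,\beta$, $$\tilde\tau_m(t)\,\tilde\tau_m(t+[\alpha]-[\beta])-(\beta-\alpha)^2\,\tilde\tau_{m-1}(t-[\beta])\,\tilde\tau_{m+1}(t+[\alpha])=\big(\tau_m(t+[\alpha]-[\beta],-t)\big)^2 .$$ (2) For every $m\ge0$, $\ \tau_m(t,s)|_{s=-t}=\tilde\tau_m(t)$. (3) For every $m\ge0$ and $k\ge1$, $\ \partial_{t_k}\tau_m(t,s)|_{s=-t}=\tfrac12\,\partial_{t_k}\tilde\tau_m(t)$. (4) For every $m\ge1$ with $\det(c_{i,j})_{i,j=0}^{m-1}\ne0$, the power series $\tilde\tau_m(t)$ is invertible and $$\partial_{t_1}^2\tau_m(t,s)|_{s=-t}=\tfrac12\,\partial_{t_1}^2\tilde\tau_m(t)-\frac1{\tilde\tau_m(t)}\Big[\tfrac14\big(\partial_{t_1}\tilde\tau_m(t)\big)^2+\tilde\tau_{m-1}(t)\,\tilde\tau_{m+1}(t)\Big].$$ (5) For every $m\ge1$ and $i,j\ge0$, $$\begin{aligned}&\sum_{k=0}^i\sum_{l=0}^j \Big(p_k(\tilde\partial_t)p_l(-\tilde\partial_t)\tau_m(t,s)|_{s=-t}\Big)\Big(p_{i-k}(\tilde\partial_t)p_{j-l}(-\tilde\partial_t)\tau_m(t,s)|_{s=-t}\Big)\\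 &=\tilde\tau_m(t)\,p_i(\tilde\partial_t)p_j(-\tilde\partial_t)\tilde\tau_m(t)-p_j(-\tilde\partial_t)\tilde\tau_{m-1}(t)\cdot p_{i-2}(\tilde\partial_t)\tilde\tau_{m+1}(t)\\ &\quad+2\,p_{j-1}(-\tilde\partial_t)\tilde\tau_{m-1}(t)\cdot p_{i-1}(\tilde\partial_t)\tilde\tau_{m+1}(t)-p_{j-2}(-\tilde\partial_t)\tilde\tau_{m-1}(t)\cdot p_i(\tilde\partial_t)\tilde\tau_{m+1}(t).\end{aligned}$$ -/

import Mathlib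

open scoped Nat

noncomputable section

namespace TodaReduction

/-- The formal variables `t₁, t₂, …` and `s₁, s₂, …` of the 2d-Toda hierarchy. -/
inductive TSVar : Type
  | t (k : ℕ+) : TSVar
  | s (k : ℕ+) : TSVar

/-- The formal variables `t₁, t₂, …` together with the two Miwa parameters `α` and `β`. -/
inductive TABVar : Type
  | t (k : ℕ+) : TABVar
  | α : TABVar
  | β : TABVar

/-! ### Moment matrix and tau functions -/

/-- The weight `∑ k · aₖ` of the `t`-part `∏ tₖ ^ aₖ` of a monomial. -/
def tWeight (d : TSVar →₀ ℕ) : ℕ :=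
  d.sum fun v n => match v with
    | .t k => (k : ℕ) * n
    | .s _ => 0

/-- The weight `∑ k · bₖ` of the `s`-part `∏ sₖ ^ bₖ` of a monomial. -/
def sWeight (d : TSVar →₀ ℕ) : ℕ :=
  d.sum fun v n => match v with
    | .t _ => 0
    | .s k => (k : ℕ) * n

/-- The degree `∑ bₖ` of the `s`-part `∏ sₖ ^ bₖ` of a monomial. -/
def sDegree (d : TSVar →₀ ℕ) : ℕ :=
  d.sum fun v n => match v with
    | .t _ => 0
    | .s _ => n

/-- The `(i, j)` entry of the time-dependent moment matrix
`m(t, s) = exp (∑ tₖ Λ ^ k) * c * exp (- ∑ sₖ (Λᵀ) ^ k)`, where `c = m(0, 0)` and `Λ` is the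
shift matrix `(δ_{i+1,j})`, as a formal power series in all times.  Since
`(Λ ^ p * c * (Λᵀ) ^ q) i j = c (i + p) (j + q)` and the powers of `Λ` commute, multiplying out the
exponential series gives the coefficient below at the monomial `∏ tₖ ^ aₖ * ∏ sₖ ^ bₖ`.
See `constantCoeff_moment`, `pderiv_t_moment`, `pderiv_s_moment` for the initial value and the
evolution equations. -/
def moment (c : Matrix ℕ ℕ ℂ) (i j : ℕ) : MvPowerSeries TSVar ℂ := fun d =>
  (-1) ^ sDegree d * ((d.prod fun _ n => n ! : ℕ) : ℂ)⁻¹ * c (i + tWeight d) (j + sWeight d)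

/-- The 2d-Toda tau function `τₘ(t, s) = det (m_{i,j}(t, s))_{0 ≤ i, j ≤ m - 1}`. -/
def tau (c : Matrix ℕ ℕ ℂ) (m : ℕ) : MvPowerSeries TSVar ℂ :=
  (Matrix.of fun i j : Fin m => moment c i j).det

variable {σ : Type*}

/-- The assignment `tₖ ↦ aₖ`, `sₖ ↦ bₖ`. -/
def timePoint (a b : ℕ+ → MvPowerSeries σ ℂ) : TSVar → MvPowerSeries σ ℂ
  | .t k => a k
  | .s k => b k

/-- `f(a, b)`: evaluation of a formal power series `f(t, s)` at times `t = a`, `s = b`. -/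
def evalTS (f : MvPowerSeries TSVar ℂ) (a b : ℕ+ → MvPowerSeries σ ℂ) : MvPowerSeries σ ℂ :=
  MvPowerSeries.subst (timePoint a b) f

/-- `g(a)`: evaluation of a formal power series `g(t)` at times `t = a`. -/
def evalT (g : MvPowerSeries ℕ+ ℂ) (a : ℕ+ → MvPowerSeries σ ℂ) : MvPowerSeries σ ℂ :=
  MvPowerSeries.subst a g

/-- The restriction `f(t, s)|_{s = -t} = f(t, -t)`, a formal power series in `t` only. -/
def restrict (f : MvPowerSeries TSVar ℂ) : MvPowerSeries ℕ+ ℂ :=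
  evalTS f MvPowerSeries.X (-MvPowerSeries.X)

/-- The symmetric tau function `τ̃ₘ(t) = τₘ(t, -t)`. -/
def symTau (c : Matrix ℕ ℕ ℂ) (m : ℕ) : MvPowerSeries ℕ+ ℂ := restrict (tau c m)

/-- The Miwa shift `[z] = (z, z² / 2, z³ / 3, …)`. -/
def miwa (z : MvPowerSeries σ ℂ) : ℕ+ → MvPowerSeries σ ℂ :=
  fun k => ((k : ℕ) : ℂ)⁻¹ • z ^ (k : ℕ)

/-- The sequence of times `t = (t₁, t₂, …)`, in the ring of power series in `t`, `α`, `β`. -/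
def times : ℕ+ → MvPowerSeries TABVar ℂ := fun k => MvPowerSeries.X (TABVar.t k)

/-- The variable `α`, in the ring of power series in `t`, `α`, `β`. -/
def varα : MvPowerSeries TABVar ℂ := MvPowerSeries.X TABVar.α

/-- The variable `β`, in the ring of power series in `t`, `α`, `β`. -/
def varβ : MvPowerSeries TABVar ℂ := MvPowerSeries.X TABVar.β

/-! ### Differential operators -/

/-- The elementary Schur polynomials `pₙ`, given by
`∑ pₙ(x) zⁿ = exp (∑_{k ≥ 1} xₖ zᵏ)` and `pₙ = 0` for `n < 0`, evaluated at a sequence `x` of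
(commuting) elements of a `ℂ`-algebra.  The powers `(∑ xₖ zᵏ) ^ r` with `r > n` do not contribute
to the coefficient of `zⁿ`. -/
def schur {A : Type*} [Ring A] [Algebra ℂ A] (x : ℕ+ → A) : ℤ → A
  | Int.ofNat n => ∑ r ∈ Finset.range (n + 1), ((r ! : ℕ) : ℂ)⁻¹ •
      PowerSeries.coeff n
        ((PowerSeries.mk fun k => if h : 0 < k then x ⟨k, h⟩ else 0) ^ r)
  | Int.negSucc _ => 0

/-- The derivative `∂ / ∂tₖ` on power series in `(t, s)`. -/
def dTS (k : ℕ+) : Module.End ℂ (MvPowerSeries TSVar ℂ) :=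
  (MvPowerSeries.pderiv ℂ (TSVar.t k)).toLinearMap

/-- The derivative `∂ / ∂tₖ` on power series in `t`. -/
def dT (k : ℕ+) : Module.End ℂ (MvPowerSeries ℕ+ ℂ) :=
  (MvPowerSeries.pderiv ℂ k).toLinearMap

/-- `∂̃ₜ = (∂_{t₁}, ∂_{t₂} / 2, ∂_{t₃} / 3, …)` on power series in `(t, s)`. -/
def scaledTS : ℕ+ → Module.End ℂ (MvPowerSeries TSVar ℂ) := fun k => ((k : ℕ) : ℂ)⁻¹ • dTS k

/-- `∂̃ₜ = (∂_{t₁}, ∂_{t₂} / 2, ∂_{t₃} / 3, …)` on power series in `t`. -/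
def scaledT : ℕ+ → Module.End ℂ (MvPowerSeries ℕ+ ℂ) := fun k => ((k : ℕ) : ℂ)⁻¹ • dT k

/-! ### The evolution equations of the moment matrix -/

theorem constantCoeff_moment (c : Matrix ℕ ℕ ℂ) (i j : ℕ) :
    MvPowerSeries.constantCoeff (moment c i j) = c i j := by
  rw [← MvPowerSeries.coeff_zero_eq_constantCoeff_apply]
  change moment c i j 0 = _
  simp [moment, tWeight, sWeight, sDegree]

theorem prod_factorial_add_single (d : TSVar →₀ ℕ) (v : TSVar) :
    ((d + Finsupp.single v 1).prod fun _ n => n !) = (d.prod fun _ n => n !) * (d v + 1) := by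
  classical
  have hz : ∀ e : TSVar →₀ ℕ, e.prod (fun _ n => n !) =
      (e v)! * (e.erase v).prod (fun _ n => n !) := fun e =>
    (Finsupp.mul_prod_erase' e v (fun _ n => n !) (fun _ => Nat.factorial_zero)).symm
  rw [hz (d + Finsupp.single v 1), hz d, Finsupp.erase_add]
  simp [Nat.factorial_succ]
  ring

theorem tWeight_add (d e : TSVar →₀ ℕ) : tWeight (d + e) = tWeight d + tWeight e := by
  refine Finsupp.sum_add_index' ?_ ?_
  · rintro (k | k) <;> rfl
  · rintro (k | k) a b <;> simp [mul_add]

theorem sWeight_add (d e : TSVar →₀ ℕ) : sWeight (d + e) = sWeight d + sWeight e := by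
  refine Finsupp.sum_add_index' ?_ ?_
  · rintro (k | k) <;> rfl
  · rintro (k | k) a b <;> simp [mul_add]

theorem sDegree_add (d e : TSVar →₀ ℕ) : sDegree (d + e) = sDegree d + sDegree e := by
  refine Finsupp.sum_add_index' ?_ ?_
  · rintro (k | k) <;> rfl
  · rintro (k | k) a b <;> simp

/-- `∂ m / ∂tₙ = Λⁿ m`. -/
theorem pderiv_t_moment (c : Matrix ℕ ℕ ℂ) (n : ℕ+) (i j : ℕ) :
    MvPowerSeries.pderiv ℂ (TSVar.t n) (moment c i j) = moment c (i + n) j := by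
  ext d
  rw [MvPowerSeries.coeff_pderiv]
  change moment c i j (d + Finsupp.single (TSVar.t n) 1) * _ = moment c (i + n) j d
  have h : ((d (TSVar.t n) : ℂ) + 1) ≠ 0 := by exact_mod_cast Nat.succ_ne_zero (d (TSVar.t n))
  have h1 : tWeight (Finsupp.single (TSVar.t n) 1) = n := by simp [tWeight]
  have h2 : sWeight (Finsupp.single (TSVar.t n) 1) = 0 := by simp [sWeight]
  have h3 : sDegree (Finsupp.single (TSVar.t n) 1) = 0 := by simp [sDegree]
  simp only [moment, prod_factorial_add_single, tWeight_add, sWeight_add, sDegree_add, h1, h2, h3,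
    add_zero, Nat.cast_mul, Nat.cast_add, Nat.cast_one, mul_inv]
  rw [show i + (tWeight d + (n : ℕ)) = i + n + tWeight d by ring]
  field_simp

/-- `∂ m / ∂sₙ = - m (Λᵀ)ⁿ`. -/
theorem pderiv_s_moment (c : Matrix ℕ ℕ ℂ) (n : ℕ+) (i j : ℕ) :
    MvPowerSeries.pderiv ℂ (TSVar.s n) (moment c i j) = -moment c i (j + n) := by
  ext d
  rw [MvPowerSeries.coeff_pderiv, map_neg]
  change moment c i j (d + Finsupp.single (TSVar.s n) 1) * _ = -moment c i (j + n) d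
  have h : ((d (TSVar.s n) : ℂ) + 1) ≠ 0 := by exact_mod_cast Nat.succ_ne_zero (d (TSVar.s n))
  have h1 : tWeight (Finsupp.single (TSVar.s n) 1) = 0 := by simp [tWeight]
  have h2 : sWeight (Finsupp.single (TSVar.s n) 1) = n := by simp [sWeight]
  have h3 : sDegree (Finsupp.single (TSVar.s n) 1) = 1 := by simp [sDegree]
  simp only [moment, prod_factorial_add_single, tWeight_add, sWeight_add, sDegree_add, h1, h2, h3,
    add_zero, Nat.cast_mul, Nat.cast_add, Nat.cast_one, mul_inv, pow_succ]
  rw [show j + (sWeight d + (n : ℕ)) = j + n + sWeight d by ring]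
  field_simp

/-! ### All evaluations used are legitimate substitutions -/

theorem hasSubst_neg {τ : Type*} {a : τ → MvPowerSeries σ ℂ} (ha : MvPowerSeries.HasSubst a) :
    MvPowerSeries.HasSubst (-a) where
  const_coeff k := by simpa using (ha.const_coeff k).neg
  coeff_zero d := by simpa using ha.coeff_zero d

theorem hasSubst_timePoint {a b : ℕ+ → MvPowerSeries σ ℂ} (ha : MvPowerSeries.HasSubst a)
    (hb : MvPowerSeries.HasSubst b) : MvPowerSeries.HasSubst (timePoint a b) where
  const_coeff v := by
    cases v with
    | t k => exact ha.const_coeff k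
    | s k => exact hb.const_coeff k
  coeff_zero d := by
    refine (((ha.coeff_zero d).image TSVar.t).union ((hb.coeff_zero d).image TSVar.s)).subset ?_
    rintro (k | k) hk
    · exact Or.inl ⟨k, hk, rfl⟩
    · exact Or.inr ⟨k, hk, rfl⟩

theorem hasSubst_times : MvPowerSeries.HasSubst times where
  const_coeff k := by simp [times]
  coeff_zero d := by
    refine Set.Finite.subset
      ((d.support.finite_toSet).preimage (f := TABVar.t) (fun a _ b _ h => by simpa using h)) ?_
    intro k hk
    classical
    simp only [times, MvPowerSeries.coeff_X, Set.mem_ofPred_eq, ne_eq, ite_eq_right_iff,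
      not_forall] at hk
    obtain ⟨rfl, -⟩ := hk
    simp

theorem hasSubst_miwa {z : MvPowerSeries σ ℂ} (hz : MvPowerSeries.constantCoeff z = 0) :
    MvPowerSeries.HasSubst (miwa z) where
  const_coeff k := by simp [miwa, hz, k.ne_zero]
  coeff_zero d := by
    refine (Set.finite_Iic (⟨d.degree + 1, Nat.succ_pos _⟩ : ℕ+)).subset ?_
    intro k hk
    by_contra hlt
    apply hk
    have hlt' : d.degree < (k : ℕ) := by
      have h0 : (⟨d.degree + 1, Nat.succ_pos _⟩ : ℕ+) < k := not_le.mp hlt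
      have h1 : d.degree + 1 < (k : ℕ) := h0
      omega
    have h2 : MvPowerSeries.coeff d (z ^ (k : ℕ)) = 0 := by
      apply MvPowerSeries.coeff_of_lt_order
      refine lt_of_lt_of_le (Nat.cast_lt.mpr hlt') ?_
      exact MvPowerSeries.le_order_pow_of_constantCoeff_eq_zero _ hz
    change MvPowerSeries.coeff d (((k : ℕ) : ℂ)⁻¹ • z ^ (k : ℕ)) = 0
    rw [MvPowerSeries.coeff_smul, h2, mul_zero]

theorem hasSubst_sub {τ : Type*} {a b : τ → MvPowerSeries σ ℂ} (ha : MvPowerSeries.HasSubst a)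
    (hb : MvPowerSeries.HasSubst b) : MvPowerSeries.HasSubst (a - b) := by
  rw [sub_eq_add_neg]
  exact ha.add (hasSubst_neg hb)

end TodaReduction

end

/-!
# Symmetric and 2d-Toda tau functions

Write `m̃(t) = m(t, -t)`, a symmetric matrix because `c` is symmetric.  Since
`exp (∑ zᵏ Λᵏ / k) = (1 - z Λ)⁻¹`, Miwa shifts act on the moment matrix by the bidiagonal matrices
`1 - z Λ` and `1 - z Λᵀ`.  Hence with `N = m̃(t + [α])` all matrices in the relation between the tau
functions are obtained from `N` by such factors:

* `m̃(t) = (1 - α Λ) N (1 - α Λᵀ)` and `m̃(t + [α] - [β]) = (1 - β Λ) N (1 - β Λᵀ)`;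
* `m̃(t - [β]) = (1 - β Λ) (1 - α Λ) N (1 - α Λᵀ) (1 - β Λᵀ)`;
* `m(t + [α] - [β], -t) = (1 - β Λ) N (1 - α Λᵀ)`.

The relation then only involves the leading `(m + 1) × (m + 1)` corner of `N`.  Choose as new rows
the first `m - 1` rows of `(1 - β Λ) (1 - α Λ)` together with the last row of each of the `m`-row
truncations of `1 - β Λ` and `1 - α Λ`, and the same for the columns.  The base change has
determinant `β - α`, and the Desnanot–Jacobi identity for the new matrix is the claim
(`leadingMinor_shift_identity`).

The Miwa shift `f(t) ↦ f(t + [z])` is encoded by its Taylor series `∑ pₙ(∂̃) f zⁿ` (`schurHom`).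
Everything needed about it follows from the recursion `n pₙ(∂̃) f = ∑ₖ pₙ₋ₖ(∂̃) ∂ₖ f`
(`succ_smul_schur_scaled`): it is multiplicative (`schurHom`), its inverse is the shift by `-[z]`
(`schurDiag_schurHom_neg`), and it acts on the moments as described
(`schurHom_eq_rowShift_colShift`).  This gives the relation as an identity in `ℂ⟦t⟧⟦α⟧⟦β⟧`
(`generating_identity`).  Its coefficients are the bilinear relations (`bilinear_relation`).  It also
yields the identity between substituted power series, since a substitution and its Taylor series
are continuous homomorphisms which agree on the variables (`algHom_ext_of_isFinitary`).

The first-order relation holds because at `s = -t` the deformations of `m̃` along `tₖ` and along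
`-sₖ` are transposes of each other (`restrict_pderiv_s_tau`).  The second-order relation is the
bilinear relation for `i = j = 1`.
-/

noncomputable section

namespace TodaReduction

/-! ### The Desnanot–Jacobi identity -/

section Determinants

variable {R : Type*} [CommRing R]

/-- Subtracting from each row a multiple of the next one does not change the determinant. -/
theorem det_sub_smul_next_row {n : ℕ} (c : Fin n → R)
    {A B : Matrix (Fin (n + 1)) (Fin (n + 1)) R}
    (hlast : ∀ j, B (Fin.last n) j = A (Fin.last n) j)
    (hcast : ∀ i j, B i.castSucc j = A i.castSucc j - c i * A i.succ j) : B.det = A.det := by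
  rw [← Matrix.det_submatrix_equiv_self Fin.revPerm A,
    ← Matrix.det_submatrix_equiv_self Fin.revPerm B]
  symm
  refine Matrix.det_eq_of_forall_row_eq_smul_add_pred (fun i => c i.rev) ?_ ?_
  · intro j
    simp [hlast]
  · intro i j
    have h := hcast i.rev (Fin.rev j)
    simp only [Matrix.submatrix_apply, Fin.revPerm_apply, Fin.rev_succ, Fin.rev_castSucc]
    rw [h]
    ring

/-- The block matrix `[A B; C D]` with only row `p` of `[C D]` and column `q` of `[B; D]` kept. -/
def bordered {n : Type*} (A : Matrix n n R) (B : Matrix n (Fin 2) R) (C : Matrix (Fin 2) n R)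
    (D : Matrix (Fin 2) (Fin 2) R) (p q : Fin 2) : Matrix (n ⊕ Fin 1) (n ⊕ Fin 1) R :=
  Matrix.fromBlocks A (B.submatrix id fun _ => q) (C.submatrix (fun _ => p) id)
    (D.submatrix (fun _ => p) fun _ => q)

theorem bordered_map {S : Type*} [CommRing S] (f : R →+* S) {n : Type*} (A : Matrix n n R)
    (B : Matrix n (Fin 2) R) (C : Matrix (Fin 2) n R) (D : Matrix (Fin 2) (Fin 2) R)
    (p q : Fin 2) :
    (bordered A B C D p q).map f = bordered (A.map f) (B.map f) (C.map f) (D.map f) p q := by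
  simp only [bordered, Matrix.fromBlocks_map, Matrix.submatrix_map]

open Matrix in
/-- If the corner `A` is invertible, both sides are `det A ^ 2` times the determinant of the
Schur complement of `A`. -/
theorem desnanot_jacobi_of_isUnit {n : Type*} [Fintype n] [DecidableEq n]
    (A : Matrix n n R) (B : Matrix n (Fin 2) R) (C : Matrix (Fin 2) n R)
    (D : Matrix (Fin 2) (Fin 2) R) (hA : IsUnit A.det) :
    (fromBlocks A B C D).det * A.det =
      (bordered A B C D 0 0).det * (bordered A B C D 1 1).det -
        (bordered A B C D 0 1).det * (bordered A B C D 1 0).det := by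
  let := A.invertibleOfIsUnitDet hA
  have key : ∀ p q : Fin 2, (bordered A B C D p q).det = A.det * (D - C * ⅟A * B) p q := by
    intro p q
    rw [bordered, det_fromBlocks₁₁]
    congr 1
    rw [det_fin_one]
    rfl
  rw [key, key, key, key, det_fromBlocks₁₁, det_fin_two]
  ring

open Matrix Polynomial in
/-- The **Desnanot–Jacobi identity**. -/
theorem desnanot_jacobi [IsDomain R] {n : Type*} [Fintype n] [DecidableEq n]
    (A : Matrix n n R) (B : Matrix n (Fin 2) R) (C : Matrix (Fin 2) n R)
    (D : Matrix (Fin 2) (Fin 2) R) :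
    (fromBlocks A B C D).det * A.det =
      (bordered A B C D 0 0).det * (bordered A B C D 1 1).det -
        (bordered A B C D 0 1).det * (bordered A B C D 1 0).det := by
  -- The matrix `X - A'` with `A' = -A` is invertible over the fraction field of `R[X]` and
  -- specializes to `A` at `X = 0`.
  have hmonic : (charmatrix (-A)).det ≠ 0 := (charpoly_monic (-A)).ne_zero
  have hinj : Function.Injective (algebraMap R[X] (FractionRing R[X])) :=
    IsFractionRing.injective _ _
  have hunit : IsUnit ((charmatrix (-A)).map (algebraMap R[X] (FractionRing R[X]))).det := by
    rw [← RingHom.mapMatrix_apply, ← RingHom.map_det, isUnit_iff_ne_zero]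
    exact (map_ne_zero_iff _ hinj).mpr hmonic
  have hpoly :
      (fromBlocks (charmatrix (-A)) (B.map Polynomial.C) (C.map Polynomial.C)
          (D.map Polynomial.C)).det * (charmatrix (-A)).det =
        (bordered (charmatrix (-A)) (B.map Polynomial.C) (C.map Polynomial.C)
            (D.map Polynomial.C) 0 0).det *
          (bordered (charmatrix (-A)) (B.map Polynomial.C) (C.map Polynomial.C)
            (D.map Polynomial.C) 1 1).det -
        (bordered (charmatrix (-A)) (B.map Polynomial.C) (C.map Polynomial.C)
            (D.map Polynomial.C) 0 1).det *
          (bordered (charmatrix (-A)) (B.map Polynomial.C) (C.map Polynomial.C)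
            (D.map Polynomial.C) 1 0).det := by
    apply hinj
    simpa only [map_mul, map_sub, RingHom.map_det, RingHom.mapMatrix_apply, fromBlocks_map,
      ← bordered_map] using desnanot_jacobi_of_isUnit _
        ((B.map Polynomial.C).map (algebraMap R[X] (FractionRing R[X])))
        ((C.map Polynomial.C).map (algebraMap R[X] (FractionRing R[X])))
        ((D.map Polynomial.C).map (algebraMap R[X] (FractionRing R[X]))) hunit
  have h0 := congrArg (Polynomial.evalRingHom (0 : R)) hpoly
  have hA0 : (charmatrix (-A)).map (Polynomial.evalRingHom (0 : R)) = A := by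
    ext i j
    by_cases h : i = j
    · subst h; simp
    · simp [h]
  have hB0 : (B.map Polynomial.C).map (Polynomial.evalRingHom (0 : R)) = B := by
    ext i j; simp
  have hC0 : (C.map Polynomial.C).map (Polynomial.evalRingHom (0 : R)) = C := by
    ext i j; simp
  have hD0 : (D.map Polynomial.C).map (Polynomial.evalRingHom (0 : R)) = D := by
    ext i j; simp
  simpa only [map_mul, map_sub, RingHom.map_det, RingHom.mapMatrix_apply, fromBlocks_map,
    bordered_map, hA0, hB0, hC0, hD0] using h0

/-- The leading principal minor `det (H i j)_{0 ≤ i, j < m}` of a semi-infinite matrix. -/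
def leadingMinor (m : ℕ) (H : ℕ → ℕ → R) : R := (Matrix.of fun i j : Fin m => H i j).det

theorem map_leadingMinor {S F : Type*} [CommRing S] [FunLike F R S] [RingHomClass F R S] (f : F)
    (m : ℕ) (H : ℕ → ℕ → R) : f (leadingMinor m H) = leadingMinor m fun i j => f (H i j) :=
  RingHom.map_det (f : R →+* S) (Matrix.of fun i j : Fin m => H i j)

theorem leadingMinor_swap (m : ℕ) (H : ℕ → ℕ → R) :
    (leadingMinor m fun i j => H j i) = leadingMinor m H :=
  Matrix.det_transpose (Matrix.of fun i j : Fin m => H i j)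

theorem leadingMinor_congr {m : ℕ} {H K : ℕ → ℕ → R} (h : ∀ i < m, ∀ j < m, H i j = K i j) :
    leadingMinor m H = leadingMinor m K := by
  unfold leadingMinor
  congr 1
  ext i j
  exact h i i.2 j j.2

/-- The Desnanot–Jacobi identity for the leading minors of a semi-infinite matrix.  The index map
`i ↦ if i < n then i else n + 1` drops the row or column `n`. -/
theorem leadingMinor_desnanot_jacobi [IsDomain R] (n : ℕ) (G : ℕ → ℕ → R) :
    leadingMinor (n + 2) G * leadingMinor n G =
      leadingMinor (n + 1) G *
        (leadingMinor (n + 1) fun i j =>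
          G (if i < n then i else n + 1) (if j < n then j else n + 1)) -
      (leadingMinor (n + 1) fun i j => G i (if j < n then j else n + 1)) *
        leadingMinor (n + 1) fun i j => G (if i < n then i else n + 1) j := by
  have h := desnanot_jacobi (Matrix.of fun i j : Fin n => G i j)
    (Matrix.of fun (i : Fin n) (q : Fin 2) => G i (n + q))
    (Matrix.of fun (p : Fin 2) (j : Fin n) => G (n + p) j)
    (Matrix.of fun p q : Fin 2 => G (n + p) (n + q))
  have key : ∀ (r : ℕ) (H : ℕ → ℕ → R), leadingMinor (n + r) H =
      ((Matrix.of fun i j : Fin (n + r) => H i j).submatrix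
        finSumFinEquiv finSumFinEquiv).det := fun r H =>
    (Matrix.det_submatrix_equiv_self _ _).symm
  have hfull : leadingMinor (n + 2) G = (Matrix.fromBlocks (Matrix.of fun i j : Fin n => G i j)
      (Matrix.of fun (i : Fin n) (q : Fin 2) => G i (n + q))
      (Matrix.of fun (p : Fin 2) (j : Fin n) => G (n + p) j)
      (Matrix.of fun p q : Fin 2 => G (n + p) (n + q))).det := by
    rw [key]
    congr 1
    ext (i | i) (j | j) <;> simp
  have hbordered : ∀ (p q : Fin 2) (f g : ℕ → ℕ), (∀ i < n, f i = i) → (∀ i < n, g i = i) →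
      f n = n + p → g n = n + q → (leadingMinor (n + 1) fun i j => G (f i) (g j)) =
        (bordered (Matrix.of fun i j : Fin n => G i j)
          (Matrix.of fun (i : Fin n) (q : Fin 2) => G i (n + q))
          (Matrix.of fun (p : Fin 2) (j : Fin n) => G (n + p) j)
          (Matrix.of fun p q : Fin 2 => G (n + p) (n + q)) p q).det := by
    intro p q f g hf hg hfn hgn
    rw [key]
    congr 1
    ext (i | i) (j | j) <;> simp [bordered, hf, hg, hfn, hgn]
  have hskip : ∀ i < n, (if i < n then i else n + 1) = i := fun i hi => if_pos hi
  have hskipn : (if n < n then n else n + 1) = n + 1 := if_neg (lt_irrefl n)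
  rw [hfull, hbordered 1 1 _ _ hskip hskip hskipn hskipn,
    hbordered 0 1 (fun i => i) _ (fun _ _ => rfl) hskip rfl hskipn,
    hbordered 1 0 _ (fun j => j) hskip (fun _ _ => rfl) hskipn rfl,
    show leadingMinor (n + 1) G = _ from
      hbordered 0 0 (fun i => i) (fun j => j) (fun _ _ => rfl) (fun _ _ => rfl) rfl rfl]
  exact h

/-! ### Shifted minors -/

/-- Left multiplication of a semi-infinite matrix by `1 - z Λ`. -/
def rowShift (z : R) (H : ℕ → ℕ → R) (i j : ℕ) : R := H i j - z * H (i + 1) j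

/-- Right multiplication of a semi-infinite matrix by `1 - z Λᵀ`. -/
def colShift (z : R) (H : ℕ → ℕ → R) (i j : ℕ) : R := H i j - z * H i (j + 1)

/-- The rows `n, …` of `H` are kept, the others are replaced by those of `(1 - z Λ) H`. -/
theorem leadingMinor_shift_lt (n : ℕ) (z : R) (H : ℕ → ℕ → R) :
    (leadingMinor (n + 1) fun i j => if i < n then H i j - z * H (i + 1) j else H i j) =
      leadingMinor (n + 1) H := by
  refine det_sub_smul_next_row (fun _ => z) ?_ ?_
  · intro j; simp
  · intro i j; simp

/-- Replacing the last two rows `x, y` by `x, x + c y` multiplies a determinant by `c`. -/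
theorem leadingMinor_add_last (n : ℕ) (c : R) (H : ℕ → ℕ → R) :
    (leadingMinor (n + 2) fun i j => if i < n + 1 then H i j else H n j + c * H (n + 1) j) =
      c * leadingMinor (n + 2) H := by
  let A := Matrix.of fun i j : Fin (n + 2) => H i j
  let k : Fin (n + 2) := ⟨n, by omega⟩
  have hrepeat : (A.updateRow (Fin.last (n + 1)) (A k)).det = 0 :=
    Matrix.det_updateRow_eq_zero (by simp [k, Fin.ext_iff])
  have h : (Matrix.of fun i j : Fin (n + 2) =>
      if (i : ℕ) < n + 1 then H i j else H n j + c * H (n + 1) j) =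
      A.updateRow (Fin.last (n + 1)) (c • A (Fin.last (n + 1)) + A k) := by
    ext i j
    induction i using Fin.lastCases with
    | last => simp [A, k, add_comm]
    | cast i =>
      have hi : (i : ℕ) < n + 1 := i.2
      simp only [Matrix.of_apply, Fin.val_castSucc, hi, if_true, A]
      rw [Matrix.updateRow_ne (Fin.castSucc_lt_last i).ne]
      rfl
  rw [leadingMinor, h, Matrix.det_updateRow_add, Matrix.det_updateRow_smul, hrepeat, add_zero,
    Matrix.updateRow_eq_self]
  rfl

/-- The rows `xᵢ - (α + β) xᵢ₊₁ + α β xᵢ₊₂` for `i < n`, `xₙ - β xₙ₊₁` and `xₙ - α xₙ₊₁`.  The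
first `n` of them together with either of the last two span the rows of `(1 - β Λ) x`, respectively
`(1 - α Λ) x`. -/
def miwaRows (n : ℕ) (α β : R) (x : ℕ → R) (i : ℕ) : R :=
  if i < n then x i - (α + β) * x (i + 1) + α * β * x (i + 2)
  else if i < n + 1 then x n - β * x (n + 1) else x n - α * x (n + 1)

/-- The rows `miwaRows n α β` arise from the rows `0, …, n + 1` by a linear map with determinant
`β - α`. -/
theorem leadingMinor_miwaRows (n : ℕ) (α β : R) (H : ℕ → ℕ → R) :
    (leadingMinor (n + 2) fun i j => miwaRows n α β (fun k => H k j) i) =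
      (β - α) * leadingMinor (n + 2) H := by
  -- Two rounds of row operations lead from `H` to a matrix `Y` with the same rows as `miwaRows`,
  -- except for the last one, which is that of `H`.
  let X : ℕ → ℕ → R := fun i j => if i < n + 1 then H i j - β * H (i + 1) j else H i j
  let Y : ℕ → ℕ → R := fun i j => if i < n then X i j - α * X (i + 1) j else X i j
  have hX : leadingMinor (n + 2) X = leadingMinor (n + 2) H := leadingMinor_shift_lt (n + 1) β H
  have hY : leadingMinor (n + 2) Y = leadingMinor (n + 2) X := by
    refine det_sub_smul_next_row (fun i : Fin (n + 1) => if (i : ℕ) < n then α else 0) ?_ ?_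
    · intro j; simp [Y]
    · intro i j
      by_cases hi : (i : ℕ) < n <;> simp [Y, hi]
  rw [← hX, ← hY, ← leadingMinor_add_last]
  refine leadingMinor_congr fun i hi j _ => ?_
  by_cases h1 : i < n
  · have h2 : i < n + 1 := by omega
    simp only [miwaRows, Y, X, h1, h2, if_true, Nat.add_lt_add_iff_right]
    ring
  · by_cases h2 : i < n + 1
    · obtain rfl : i = n := by omega
      simp [miwaRows, Y, X]
    · simp only [miwaRows, Y, X, h1, h2, if_false, lt_irrefl, Nat.lt_succ_self, if_true,
        show ¬ n + 1 < n by omega]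
      ring

/-- The first `n + 1` of the rows `miwaRows n α β` are unitriangular combinations of those of
`(1 - β Λ) H`. -/
theorem leadingMinor_miwaRows_first (n : ℕ) (α β : R) (H : ℕ → ℕ → R) :
    (leadingMinor (n + 1) fun i j => miwaRows n α β (fun k => H k j) i) =
      leadingMinor (n + 1) (rowShift β H) := by
  rw [← leadingMinor_shift_lt n α (rowShift β H)]
  refine leadingMinor_congr fun i hi j _ => ?_
  by_cases h1 : i < n
  · simp only [miwaRows, h1, if_true, rowShift]
    ring
  · obtain rfl : i = n := by omega
    simp [miwaRows, rowShift]

/-- The rows `miwaRows n α β` other than row `n` are unitriangular combinations of those of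
`(1 - α Λ) H`. -/
theorem leadingMinor_miwaRows_skip (n : ℕ) (α β : R) (H : ℕ → ℕ → R) :
    (leadingMinor (n + 1) fun i j =>
        miwaRows n α β (fun k => H k j) (if i < n then i else n + 1)) =
      leadingMinor (n + 1) (rowShift α H) := by
  rw [← leadingMinor_shift_lt n β (rowShift α H)]
  refine leadingMinor_congr fun i hi j _ => ?_
  by_cases h1 : i < n
  · simp only [miwaRows, h1, if_true, rowShift]
    ring
  · obtain rfl : i = n := by omega
    simp [miwaRows, rowShift]

theorem rowShift_miwaRows (n : ℕ) (α β z : R) (H : ℕ → ℕ → R) :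
    rowShift z (fun k j => miwaRows n α β (H k) j) =
      fun i j => miwaRows n α β (rowShift z H i) j := by
  ext i j
  simp only [rowShift, miwaRows]
  split_ifs <;> ring

theorem leadingMinor_miwaCols_first (n : ℕ) (α β : R) (H : ℕ → ℕ → R) :
    (leadingMinor (n + 1) fun i j => miwaRows n α β (H i) j) =
      leadingMinor (n + 1) (colShift β H) := by
  rw [← leadingMinor_swap, leadingMinor_miwaRows_first n α β fun k j => H j k,
    ← leadingMinor_swap]
  rfl

theorem leadingMinor_miwaCols_skip (n : ℕ) (α β : R) (H : ℕ → ℕ → R) :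
    (leadingMinor (n + 1) fun i j => miwaRows n α β (H i) (if j < n then j else n + 1)) =
      leadingMinor (n + 1) (colShift α H) := by
  rw [← leadingMinor_swap, leadingMinor_miwaRows_skip n α β fun k j => H j k,
    ← leadingMinor_swap]
  rfl

theorem rowShift_colShift_comm (z w : R) (H : ℕ → ℕ → R) :
    rowShift z (colShift w H) = colShift w (rowShift z H) := by
  ext i j
  simp only [rowShift, colShift]
  ring

/-- The Desnanot–Jacobi identity for the matrix obtained from the `(n + 2) × (n + 2)` corner of
`N` by the operations `miwaRows` on rows and columns. -/
theorem leadingMinor_shift_identity [IsDomain R] (n : ℕ) (α β : R) (N : ℕ → ℕ → R) :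
    leadingMinor (n + 1) (rowShift α (colShift α N)) *
        leadingMinor (n + 1) (rowShift β (colShift β N)) -
      (β - α) ^ 2 * leadingMinor n (rowShift β (colShift β (rowShift α (colShift α N)))) *
        leadingMinor (n + 2) N =
      leadingMinor (n + 1) (rowShift β (colShift α N)) *
        leadingMinor (n + 1) (rowShift α (colShift β N)) := by
  let P : ℕ → ℕ → R := fun k j => miwaRows n α β (N k) j
  have hP : ∀ z, rowShift z P = fun i j => miwaRows n α β (rowShift z N i) j := fun z =>
    rowShift_miwaRows n α β z N
  have h := leadingMinor_desnanot_jacobi n fun i j => miwaRows n α β (fun k => P k j) i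
  have hfull : (leadingMinor (n + 2) fun i j => miwaRows n α β (fun k => P k j) i) =
      (β - α) ^ 2 * leadingMinor (n + 2) N := by
    rw [leadingMinor_miwaRows, ← leadingMinor_swap (n + 2) P,
      leadingMinor_miwaRows n α β fun k j => N j k, leadingMinor_swap]
    ring
  have hcorner : (leadingMinor n fun i j => miwaRows n α β (fun k => P k j) i) =
      leadingMinor n (rowShift β (colShift β (rowShift α (colShift α N)))) := by
    refine leadingMinor_congr fun i hi j hj => ?_
    simp only [P, miwaRows, hi, hj, if_true, rowShift, colShift]
    ring
  have h00 : (leadingMinor (n + 1) fun i j => miwaRows n α β (fun k => P k j) i) =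
      leadingMinor (n + 1) (rowShift β (colShift β N)) := by
    rw [leadingMinor_miwaRows_first, hP, leadingMinor_miwaCols_first, rowShift_colShift_comm]
  have h11 : (leadingMinor (n + 1) fun i j => miwaRows n α β
      (fun k => P k (if j < n then j else n + 1)) (if i < n then i else n + 1)) =
      leadingMinor (n + 1) (rowShift α (colShift α N)) := by
    rw [leadingMinor_miwaRows_skip n α β fun k j => P k (if j < n then j else n + 1),
      rowShift_colShift_comm, ← leadingMinor_miwaCols_skip n α β (rowShift α N)]
    exact leadingMinor_congr fun i _ j _ => congrFun (congrFun (hP α) i) _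
  have h01 : (leadingMinor (n + 1) fun i j => miwaRows n α β
      (fun k => P k (if j < n then j else n + 1)) i) =
      leadingMinor (n + 1) (rowShift β (colShift α N)) := by
    rw [leadingMinor_miwaRows_first n α β fun k j => P k (if j < n then j else n + 1),
      rowShift_colShift_comm, ← leadingMinor_miwaCols_skip n α β (rowShift β N)]
    exact leadingMinor_congr fun i _ j _ => congrFun (congrFun (hP β) i) _
  have h10 : (leadingMinor (n + 1) fun i j => miwaRows n α β
      (fun k => P k j) (if i < n then i else n + 1)) =
      leadingMinor (n + 1) (rowShift α (colShift β N)) := by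
    rw [leadingMinor_miwaRows_skip, hP, leadingMinor_miwaCols_first, rowShift_colShift_comm]
  rw [hfull, hcorner, h00, h11, h01, h10] at h
  linear_combination -h

/-- For symmetric `N` the right-hand side of `leadingMinor_shift_identity` is a square. -/
theorem leadingMinor_shift_identity_of_symm [IsDomain R] (n : ℕ) (α β : R) {N : ℕ → ℕ → R}
    (hN : ∀ i j, N i j = N j i) :
    leadingMinor (n + 1) (rowShift α (colShift α N)) *
        leadingMinor (n + 1) (rowShift β (colShift β N)) -
      (β - α) ^ 2 * leadingMinor n (rowShift β (colShift β (rowShift α (colShift α N)))) *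
        leadingMinor (n + 2) N =
      leadingMinor (n + 1) (rowShift β (colShift α N)) ^ 2 := by
  rw [leadingMinor_shift_identity, sq, ← leadingMinor_swap (n + 1) (rowShift α (colShift β N))]
  congr 1
  refine leadingMinor_congr fun i _ j _ => ?_
  simp only [rowShift, colShift, hN j i, hN (j + 1) i, hN j (i + 1), hN (j + 1) (i + 1)]
  ring

end Determinants

/-! ### Elementary Schur polynomials -/

section Schur

theorem map_schur {A B : Type*} [Ring A] [Algebra ℂ A] [Ring B] [Algebra ℂ B] (f : A →ₐ[ℂ] B)
    (x : ℕ+ → A) (n : ℤ) : f (schur x n) = schur (fun k => f (x k)) n := by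
  cases n with
  | negSucc n => exact map_zero f
  | ofNat n =>
    have hg : (PowerSeries.mk fun k => if h : 0 < k then f (x ⟨k, h⟩) else 0) =
        PowerSeries.map (f : A →+* B)
          (PowerSeries.mk fun k => if h : 0 < k then x ⟨k, h⟩ else 0) := by
      ext k
      by_cases h : 0 < k <;> simp [h]
    simp only [schur, map_sum, map_smul, hg]
    refine Finset.sum_congr rfl fun r _ => ?_
    rw [← map_pow, PowerSeries.coeff_map]
    rfl

theorem schur_zero {A : Type*} [Ring A] [Algebra ℂ A] (x : ℕ+ → A) : schur x 0 = 1 := by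
  change schur x (Int.ofNat 0) = 1
  simp [schur]

/-- The derivative of `∑ pₙ(x) zⁿ = exp (∑ xₖ zᵏ)`, coefficient by coefficient. -/
theorem succ_smul_schur_succ_of_comm {A : Type*} [CommRing A] [Algebra ℂ A] (x : ℕ+ → A)
    (n : ℕ) : ((n + 1 : ℕ) : ℂ) • schur x ((n + 1 : ℕ) : ℤ) =
      ∑ p ∈ Finset.HasAntidiagonal.antidiagonal n,
        schur x (p.1 : ℤ) * ((p.2 + 1 : ℕ) : ℂ) • x p.2.succPNat := by
  set g : PowerSeries A := PowerSeries.mk fun k => if h : 0 < k then x ⟨k, h⟩ else 0 with hg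
  let G : ℕ → PowerSeries A := fun N => ∑ r ∈ Finset.range N, ((r ! : ℕ) : ℂ)⁻¹ • g ^ r
  have hX : PowerSeries.X ∣ g := by
    rw [PowerSeries.X_dvd_iff, ← PowerSeries.coeff_zero_eq_constantCoeff_apply]
    simp [hg]
  have hlow : ∀ a r : ℕ, a < r → PowerSeries.coeff a (g ^ r) = 0 := fun a r har =>
    PowerSeries.X_pow_dvd_iff.mp (pow_dvd_pow_of_dvd hX r) a har
  -- The truncations `G N` of the exponential series have the correct low coefficients.
  have hG : ∀ a N : ℕ, a < N → PowerSeries.coeff a (G N) = schur x (a : ℤ) := by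
    intro a N haN
    change _ = schur x (Int.ofNat a)
    simp only [G, schur, map_sum, PowerSeries.coeff_smul]
    symm
    refine Finset.sum_subset (Finset.range_subset_range.mpr haN) fun r _ hr => ?_
    rw [← hg, hlow a r (by simpa using hr), smul_zero]
  have hderiv : PowerSeries.derivative A (G (n + 2)) =
      G (n + 1) * PowerSeries.derivative A g := by
    simp only [G]
    rw [Finset.sum_range_succ', map_add, map_sum, Finset.sum_mul]
    simp only [pow_zero, Nat.factorial_zero, Nat.cast_one, inv_one, one_smul]
    rw [PowerSeries.derivative_one, add_zero]
    refine Finset.sum_congr rfl fun r _ => ?_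
    have hr : (((r + 1) ! : ℕ) : ℂ)⁻¹ * ((r + 1 : ℕ) : ℂ) = ((r ! : ℕ) : ℂ)⁻¹ := by
      rw [Nat.factorial_succ, Nat.cast_mul, mul_inv, mul_comm, ← mul_assoc,
        mul_inv_cancel₀ (Nat.cast_ne_zero.mpr (Nat.succ_ne_zero r)), one_mul]
    have hs : PowerSeries.derivative A ((((r + 1) ! : ℕ) : ℂ)⁻¹ • g ^ (r + 1)) =
        (((r + 1) ! : ℕ) : ℂ)⁻¹ • PowerSeries.derivative A (g ^ (r + 1)) :=
      Derivation.map_smul_of_tower _ _ _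
    rw [hs, PowerSeries.derivative_pow, ← hr, mul_smul, Nat.add_sub_cancel, Nat.cast_smul_eq_nsmul,
      nsmul_eq_mul, smul_mul_assoc, mul_assoc]
  have h := congrArg (PowerSeries.coeff n) hderiv
  rw [PowerSeries.coeff_derivative, hG _ _ (by omega), PowerSeries.coeff_mul] at h
  rw [Nat.cast_smul_eq_nsmul, nsmul_eq_mul, Nat.cast_succ, mul_comm, h]
  refine Finset.sum_congr rfl fun p hp => ?_
  rw [hG _ _ (by have := Finset.HasAntidiagonal.mem_antidiagonal.mp hp; omega), PowerSeries.coeff_derivative]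
  rw [Nat.cast_smul_eq_nsmul, nsmul_eq_mul, Nat.cast_succ, mul_comm (_ + 1 : A)]
  simp [hg, Nat.succPNat]

/-- Commuting elements of an algebra lie in a commutative subalgebra, so that identities between
Schur polynomials need only be checked in commutative algebras. -/
theorem exists_comm_lift {A ι : Type*} [Ring A] [Algebra ℂ A] (x : ι → A)
    (hx : ∀ k l, x k * x l = x l * x k) :
    ∃ (S : Subalgebra ℂ A) (_ : ∀ a b : S, a * b = b * a) (y : ι → S), ∀ k, (y k : A) = x k := by
  have := Algebra.isMulCommutative_adjoin ℂ (s := Set.range x)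
    (by rintro _ ⟨k, rfl⟩ _ ⟨l, rfl⟩; exact hx k l)
  exact ⟨Algebra.adjoin ℂ (Set.range x), fun a b => mul_comm' a b,
    fun k => ⟨x k, Algebra.subset_adjoin ⟨k, rfl⟩⟩, fun _ => rfl⟩

/-- The recursion `n pₙ = ∑ pₙ₋ₖ · k xₖ` for commuting elements of an algebra. -/
theorem succ_smul_schur_succ {A : Type*} [Ring A] [Algebra ℂ A] (x : ℕ+ → A)
    (hx : ∀ k l, x k * x l = x l * x k) (n : ℕ) :
    ((n + 1 : ℕ) : ℂ) • schur x ((n + 1 : ℕ) : ℤ) =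
      ∑ p ∈ Finset.HasAntidiagonal.antidiagonal n,
        schur x (p.1 : ℤ) * ((p.2 + 1 : ℕ) : ℂ) • x p.2.succPNat := by
  obtain ⟨S, hS, y, hy⟩ := exists_comm_lift x hx
  let _ : CommRing S := { (inferInstance : Ring S) with mul_comm := hS }
  have h := congrArg S.val (succ_smul_schur_succ_of_comm y n)
  simpa only [map_smul, map_sum, map_mul, map_schur, Subalgebra.coe_val, hy] using h

/-- `exp (∑ xₖ zᵏ) * exp (- ∑ xₖ zᵏ) = 1`. -/
theorem sum_schur_mul_schur_neg {A : Type*} [Ring A] [Algebra ℂ A] (x : ℕ+ → A)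
    (hx : ∀ k l, x k * x l = x l * x k) (n : ℕ) :
    ∑ p ∈ Finset.HasAntidiagonal.antidiagonal (n + 1), schur x (p.1 : ℤ) * schur (-x) (p.2 : ℤ) = 0 := by
  suffices H : ∀ {B : Type _} [CommRing B] [Algebra ℂ B] (y : ℕ+ → B),
      ∑ p ∈ Finset.HasAntidiagonal.antidiagonal (n + 1), schur y (p.1 : ℤ) * schur (-y) (p.2 : ℤ) = 0 by
    obtain ⟨S, hS, y, hy⟩ := exists_comm_lift x hx
    let _ : CommRing S := { (inferInstance : Ring S) with mul_comm := hS }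
    have h := congrArg S.val (H y)
    simp only [map_sum, map_mul, map_schur, Subalgebra.coe_val, hy, map_zero, Pi.neg_apply,
      map_neg] at h
    exact h
  intro B _ _ y
  let E : (ℕ+ → B) → PowerSeries B := fun x => PowerSeries.mk fun n => schur x (n : ℤ)
  let g : PowerSeries B := PowerSeries.mk fun k => ((k + 1 : ℕ) : ℂ) • y k.succPNat
  have hE : ∀ (x : ℕ+ → B) (k : PowerSeries B),
      (k = PowerSeries.mk fun k => ((k + 1 : ℕ) : ℂ) • x k.succPNat) →
      PowerSeries.derivative B (E x) = E x * k := by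
    rintro x _ rfl
    ext m
    rw [PowerSeries.coeff_derivative, PowerSeries.coeff_mul]
    simp only [E, PowerSeries.coeff_mk]
    rw [← succ_smul_schur_succ_of_comm, Nat.cast_smul_eq_nsmul, nsmul_eq_mul, mul_comm]
    simp only [Nat.cast_add, Nat.cast_one]
  have hd : PowerSeries.derivative B (E y * E (-y)) = 0 := by
    rw [Derivation.leibniz, hE y g rfl, hE (-y) (-g) (by ext; simp [g])]
    simp only [smul_eq_mul]
    ring
  have h := congrArg (PowerSeries.coeff n) hd
  rw [PowerSeries.coeff_derivative, map_zero] at h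
  have hunit : ((n : B) + 1) * algebraMap ℂ B ((n : ℂ) + 1)⁻¹ = 1 := by
    have h1 : ((n : B) + 1) = algebraMap ℂ B ((n : ℂ) + 1) := by simp
    rw [h1, ← map_mul, mul_inv_cancel₀ (Nat.cast_add_one_ne_zero n), map_one]
  have h2 := congrArg (· * algebraMap ℂ B ((n : ℂ) + 1)⁻¹) h
  simp only [mul_assoc, hunit, mul_one, zero_mul, PowerSeries.coeff_mul, E,
    PowerSeries.coeff_mk] at h2
  exact h2

end Schur

/-! ### Schur polynomials of commuting derivations -/

section Derivations

variable {R : Type*} [CommRing R] [Algebra ℂ R]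

/-- The operators `D₁, D₂ / 2, D₃ / 3, …`. -/
def scaled (D : ℕ+ → Derivation ℂ R R) : ℕ+ → Module.End ℂ R :=
  fun k => ((k : ℕ) : ℂ)⁻¹ • (D k).toLinearMap

theorem scaled_neg (D : ℕ+ → Derivation ℂ R R) : scaled (-D) = -scaled D := by
  ext k f
  simp [scaled]

theorem scaled_comm {D : ℕ+ → Derivation ℂ R R} (hD : ∀ k l f, D k (D l f) = D l (D k f))
    (k l : ℕ+) : scaled D k * scaled D l = scaled D l * scaled D k := by
  ext f
  simp only [scaled, Module.End.mul_apply, LinearMap.smul_apply, 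
    Derivation.coeFn_coe, map_smul, hD k l]
  rw [smul_comm]

/-- The recursion `n pₙ f = ∑ pₙ₋ₖ (Dₖ f)`, in which the factors `1 / k` of `scaled D` have
cancelled. -/
theorem succ_smul_schur_scaled {D : ℕ+ → Derivation ℂ R R}
    (hD : ∀ k l f, D k (D l f) = D l (D k f)) (n : ℕ) (f : R) :
    ((n + 1 : ℕ) : ℂ) • schur (scaled D) ((n + 1 : ℕ) : ℤ) f =
      ∑ p ∈ Finset.HasAntidiagonal.antidiagonal n, schur (scaled D) (p.1 : ℤ) (D p.2.succPNat f) := by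
  have h := congrArg (fun T : Module.End ℂ R => T f)
    (succ_smul_schur_succ (scaled D) (scaled_comm hD) n)
  simp only [LinearMap.smul_apply, LinearMap.sum_apply, Module.End.mul_apply] at h
  rw [h]
  refine Finset.sum_congr rfl fun p _ => ?_
  congr 1
  simp only [scaled, LinearMap.smul_apply, Derivation.coeFn_coe,
    Nat.succPNat_coe, Nat.succ_eq_add_one]
  rw [smul_smul, mul_inv_cancel₀ (Nat.cast_ne_zero.mpr (Nat.succ_ne_zero _)), one_smul]

/-- A sequence satisfying the recursion of the Schur polynomials is given by them. -/
theorem schur_scaled_eq {D : ℕ+ → Derivation ℂ R R}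
    (hD : ∀ k l f, D k (D l f) = D l (D k f)) {ι : Type*} (v : ι → R) (q : ℕ → ι → R)
    (h0 : ∀ i, q 0 i = v i)
    (hrec : ∀ (n : ℕ) (i : ι), (∀ a : ℕ, a ≤ n → ∀ j, schur (scaled D) ((a : ℕ) : ℤ) (v j) = q a j) →
      ∑ p ∈ Finset.HasAntidiagonal.antidiagonal n, schur (scaled D) (p.1 : ℤ) (D p.2.succPNat (v i)) =
        ((n + 1 : ℕ) : ℂ) • q (n + 1) i) (n : ℕ) (i : ι) :
    schur (scaled D) (n : ℤ) (v i) = q n i := by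
  induction n using Nat.strong_induction_on generalizing i with
  | _ n ih =>
    cases n with
    | zero => rw [h0, Nat.cast_zero, schur_zero]; rfl
    | succ n =>
      have hn : ((n + 1 : ℕ) : ℂ) ≠ 0 := Nat.cast_ne_zero.mpr (Nat.succ_ne_zero n)
      have h := succ_smul_schur_scaled hD n (v i)
      rw [hrec n i fun a ha j => ih a (by omega) j] at h
      exact smul_right_injective R hn h

/-- The operators `pₙ` of commuting derivations satisfy the Leibniz rule of divided powers. -/
theorem schur_scaled_mul {D : ℕ+ → Derivation ℂ R R}
    (hD : ∀ k l f, D k (D l f) = D l (D k f)) (n : ℕ) (f g : R) :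
    schur (scaled D) (n : ℤ) (f * g) = ∑ p ∈ Finset.HasAntidiagonal.antidiagonal n,
      schur (scaled D) (p.1 : ℤ) f * schur (scaled D) (p.2 : ℤ) g := by
  refine schur_scaled_eq hD (fun i : R × R => i.1 * i.2)
    (fun n i => ∑ p ∈ Finset.HasAntidiagonal.antidiagonal n,
      schur (scaled D) (p.1 : ℤ) i.1 * schur (scaled D) (p.2 : ℤ) i.2) ?_ ?_ n (f, g)
  · intro i
    simp [schur_zero]
  · rintro n ⟨f, g⟩ ih
    have hsplit : ∀ p ∈ Finset.HasAntidiagonal.antidiagonal n,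
        schur (scaled D) (p.1 : ℤ) (D p.2.succPNat (f * g)) =
          (∑ q ∈ Finset.HasAntidiagonal.antidiagonal p.1, schur (scaled D) (q.1 : ℤ) f *
            schur (scaled D) (q.2 : ℤ) (D p.2.succPNat g)) +
          ∑ q ∈ Finset.HasAntidiagonal.antidiagonal p.1, schur (scaled D) (q.1 : ℤ) g *
            schur (scaled D) (q.2 : ℤ) (D p.2.succPNat f) := by
      intro p hp
      have hle : p.1 ≤ n := by
        have := Finset.HasAntidiagonal.mem_antidiagonal.mp hp
        omega
      rw [Derivation.leibniz, smul_eq_mul, smul_eq_mul, map_add]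
      exact congrArg₂ (· + ·) (ih p.1 hle (f, D p.2.succPNat g)) (ih p.1 hle (g, D p.2.succPNat f))
    -- Sum over triples, grouping the derivative with the index of the factor it falls on.
    have hgroup : ∀ f g : R, ∑ p ∈ Finset.HasAntidiagonal.antidiagonal n,
        ∑ q ∈ Finset.HasAntidiagonal.antidiagonal p.1, schur (scaled D) (q.1 : ℤ) f *
          schur (scaled D) (q.2 : ℤ) (D p.2.succPNat g) =
        ∑ p ∈ Finset.HasAntidiagonal.antidiagonal n, schur (scaled D) (p.1 : ℤ) f *
          (((p.2 + 1 : ℕ) : ℂ) • schur (scaled D) ((p.2 + 1 : ℕ) : ℤ) g) := by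
      intro f g
      simp only [succ_smul_schur_scaled hD, Finset.mul_sum, Finset.sum_sigma']
      refine Finset.sum_nbij' (fun x => ⟨(x.2.1, x.2.2 + x.1.2), (x.2.2, x.1.2)⟩)
        (fun x => ⟨(x.1.1 + x.2.1, x.2.2), (x.1.1, x.2.1)⟩) ?_ ?_ ?_ ?_ ?_
      · rintro ⟨⟨a, b⟩, u, v⟩ hx
        simp only [Finset.mem_sigma, Finset.HasAntidiagonal.mem_antidiagonal, and_true] at hx ⊢
        omega
      · rintro ⟨⟨a, b⟩, u, v⟩ hx
        simp only [Finset.mem_sigma, Finset.HasAntidiagonal.mem_antidiagonal, and_true] at hx ⊢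
        omega
      · rintro ⟨⟨a, b⟩, u, v⟩ hx
        simp only [Finset.mem_sigma, Finset.HasAntidiagonal.mem_antidiagonal] at hx
        simp only [hx.2]
      · rintro ⟨⟨a, b⟩, u, v⟩ hx
        simp only [Finset.mem_sigma, Finset.HasAntidiagonal.mem_antidiagonal] at hx
        simp only [hx.2]
      · intro x _
        rfl
    rw [Finset.sum_congr rfl hsplit, Finset.sum_add_distrib, hgroup, hgroup]
    have hweight : ((n + 1 : ℕ) : ℂ) • ∑ p ∈ Finset.HasAntidiagonal.antidiagonal (n + 1),
        schur (scaled D) (p.1 : ℤ) f * schur (scaled D) (p.2 : ℤ) g =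
        ∑ p ∈ Finset.HasAntidiagonal.antidiagonal (n + 1),
          schur (scaled D) (p.1 : ℤ) f * ((p.2 : ℂ) • schur (scaled D) (p.2 : ℤ) g) +
        ∑ p ∈ Finset.HasAntidiagonal.antidiagonal (n + 1),
          ((p.1 : ℂ) • schur (scaled D) (p.1 : ℤ) f) * schur (scaled D) (p.2 : ℤ) g := by
      rw [Finset.smul_sum, ← Finset.sum_add_distrib]
      refine Finset.sum_congr rfl fun p hp => ?_
      rw [← Finset.HasAntidiagonal.mem_antidiagonal.mp hp, Nat.cast_add, add_smul,
        mul_smul_comm, smul_mul_assoc, add_comm]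
    rw [hweight, Finset.Nat.sum_antidiagonal_succ', Finset.Nat.sum_antidiagonal_succ]
    simp only [Nat.cast_zero, zero_smul, mul_zero, zero_mul, zero_add]
    congr 1
    rw [← Finset.Nat.sum_antidiagonal_swap]
    exact Finset.sum_congr rfl fun p _ => mul_comm _ _

/-- The Taylor series `f ↦ ∑ pₙ(D₁, D₂ / 2, …) f zⁿ`, that is `f ↦ f(t + [z])` when `Dₖ` is the
derivative with respect to `tₖ`, as an algebra homomorphism. -/
def schurHom {D : ℕ+ → Derivation ℂ R R} (hD : ∀ k l f, D k (D l f) = D l (D k f)) :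
    R →ₐ[ℂ] PowerSeries R :=
  AlgHom.ofLinearMap
    { toFun := fun f => PowerSeries.mk fun n => schur (scaled D) (n : ℤ) f
      map_add' := fun f g => by ext n; simp
      map_smul' := fun c f => by
        ext n; simp }
    (by
      ext n
      have h := schur_scaled_eq hD (fun _ : Unit => (1 : R)) (fun n _ => if n = 0 then 1 else 0)
        (by simp) (fun n i _ => by simp) n ()
      simp only [LinearMap.coe_mk, AddHom.coe_mk, PowerSeries.coeff_mk, h, PowerSeries.coeff_one])
    (fun f g => by
      ext n
      simp only [LinearMap.coe_mk, AddHom.coe_mk, PowerSeries.coeff_mk, PowerSeries.coeff_mul]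
      exact schur_scaled_mul hD n f g)

theorem coeff_schurHom {D : ℕ+ → Derivation ℂ R R} (hD : ∀ k l f, D k (D l f) = D l (D k f))
    (n : ℕ) (f : R) : PowerSeries.coeff n (schurHom hD f) = schur (scaled D) (n : ℤ) f := by
  change PowerSeries.coeff n (PowerSeries.mk fun n : ℕ => schur (scaled D) (n : ℤ) f) = _
  rw [PowerSeries.coeff_mk]

/-- `f(t + [z] - [z]) = f(t)`. -/
theorem sum_schur_scaled_schur_scaled_neg {D : ℕ+ → Derivation ℂ R R}
    (hD : ∀ k l f, D k (D l f) = D l (D k f)) (n : ℕ) (f : R) :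
    ∑ p ∈ Finset.HasAntidiagonal.antidiagonal n,
      schur (scaled D) (p.1 : ℤ) (schur (scaled (-D)) (p.2 : ℤ) f) = if n = 0 then f else 0 := by
  cases n with
  | zero => simp [schur_zero]
  | succ n =>
    have h := congrArg (fun T : Module.End ℂ R => T f)
      (sum_schur_mul_schur_neg (scaled D) (scaled_comm hD) n)
    simp only [LinearMap.sum_apply, Module.End.mul_apply, ← scaled_neg] at h
    rw [h]
    rfl

end Derivations

/-! ### Homomorphisms determined by the variables -/

section Finitary

variable {σ τ : Type*}

/-- A function of a formal power series which depends on finitely many coefficients only. -/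
def IsFinitary (l : MvPowerSeries σ ℂ → ℂ) : Prop :=
  ∃ s : Finset (σ →₀ ℕ), ∀ f g : MvPowerSeries σ ℂ,
    (∀ e ∈ s, MvPowerSeries.coeff e f = MvPowerSeries.coeff e g) → l f = l g

theorem isFinitary_coeff (d : σ →₀ ℕ) :
    IsFinitary fun f : MvPowerSeries σ ℂ => MvPowerSeries.coeff d f :=
  ⟨{d}, fun _ _ h => h d (Finset.mem_singleton_self d)⟩

theorem isFinitary_const (z : ℂ) : IsFinitary fun _ : MvPowerSeries σ ℂ => z :=
  ⟨∅, fun _ _ _ => rfl⟩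

theorem IsFinitary.op₂ {l l' : MvPowerSeries σ ℂ → ℂ} (h : IsFinitary l) (h' : IsFinitary l')
    (F : ℂ → ℂ → ℂ) : IsFinitary fun f => F (l f) (l' f) := by
  classical
  obtain ⟨s, hs⟩ := h
  obtain ⟨s', hs'⟩ := h'
  refine ⟨s ∪ s', fun f g hfg => ?_⟩
  simp only [hs f g fun e he => hfg e (Finset.mem_union_left _ he),
    hs' f g fun e he => hfg e (Finset.mem_union_right _ he)]

theorem IsFinitary.sum {ι : Type*} (t : Finset ι) {l : ι → MvPowerSeries σ ℂ → ℂ}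
    (h : ∀ i ∈ t, IsFinitary (l i)) : IsFinitary fun f => ∑ i ∈ t, l i f := by
  classical
  induction t using Finset.induction_on with
  | empty => simpa using isFinitary_const 0
  | insert a t ha ih =>
    simp only [Finset.sum_insert ha]
    exact (h a (Finset.mem_insert_self a t)).op₂
      (ih fun i hi => h i (Finset.mem_insert_of_mem hi)) (· + ·)

theorem IsFinitary.comp {l : MvPowerSeries τ ℂ → ℂ} (h : IsFinitary l)
    {L : MvPowerSeries σ ℂ → MvPowerSeries τ ℂ}
    (hL : ∀ d, IsFinitary fun f => MvPowerSeries.coeff d (L f)) : IsFinitary fun f => l (L f) := by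
  classical
  obtain ⟨s, hs⟩ := h
  choose u hu using hL
  refine ⟨s.biUnion u, fun f g hfg => hs _ _ fun e he => hu e f g fun a ha => ?_⟩
  exact hfg a (Finset.mem_biUnion.mpr ⟨e, he, ha⟩)

theorem isFinitary_subst {a : σ → MvPowerSeries τ ℂ} (ha : MvPowerSeries.HasSubst a)
    (d : τ →₀ ℕ) : IsFinitary fun f : MvPowerSeries σ ℂ =>
      MvPowerSeries.coeff d (MvPowerSeries.subst a f) := by
  -- Only exponents `e` for which `aᵉ` has a nonzero coefficient at `d` matter; the series all of
  -- whose coefficients are `1` shows that there are finitely many of them.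
  have hfin := MvPowerSeries.coeff_subst_finite ha (fun _ => (1 : ℂ)) d
  refine ⟨hfin.toFinset, fun f g hfg => ?_⟩
  beta_reduce
  rw [MvPowerSeries.coeff_subst ha, MvPowerSeries.coeff_subst ha]
  refine finsum_congr fun e => ?_
  by_cases he : MvPowerSeries.coeff d (e.prod fun s e => (a s) ^ e) = 0
  · rw [he, smul_zero, smul_zero]
  · rw [hfg e]
    refine (Set.Finite.mem_toFinset hfin).mpr ?_
    rw [Function.mem_support]
    have h1 : MvPowerSeries.coeff e (fun _ => (1 : ℂ) : MvPowerSeries σ ℂ) = 1 := rfl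
    rw [h1, one_smul]
    exact he

theorem isFinitary_pderiv (i : σ) (d : σ →₀ ℕ) :
    IsFinitary fun f : MvPowerSeries σ ℂ =>
      MvPowerSeries.coeff d (MvPowerSeries.pderiv ℂ i f) := by
  simp only [MvPowerSeries.coeff_pderiv]
  exact (isFinitary_coeff _).op₂ (isFinitary_const _) (· * ·)

/-- Two algebra homomorphisms on a power series ring which agree on the variables are equal if they
are continuous, in the sense that suitable coordinates of their values depend on finitely many
coefficients. -/
theorem algHom_ext_of_isFinitary {A ι : Type*} [CommRing A] [Algebra ℂ A]
    {f g : MvPowerSeries σ ℂ →ₐ[ℂ] A} (l : ι → A → ℂ) (hl : ∀ a b, (∀ i, l i a = l i b) → a = b)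
    (hf : ∀ i, IsFinitary fun x => l i (f x)) (hg : ∀ i, IsFinitary fun x => l i (g x))
    (hX : ∀ v, f (MvPowerSeries.X v) = g (MvPowerSeries.X v)) : f = g := by
  classical
  have hpoly : ∀ p : MvPolynomial σ ℂ, f p = g p := by
    have h : f.comp (MvPolynomial.coeToMvPowerSeries.algHom ℂ) =
        g.comp (MvPolynomial.coeToMvPowerSeries.algHom ℂ) := by
      refine MvPolynomial.algHom_ext fun v => ?_
      simpa using hX v
    intro p
    simpa using DFunLike.congr_fun h p
  refine AlgHom.ext fun x => hl _ _ fun i => ?_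
  obtain ⟨s, hs⟩ := hf i
  obtain ⟨u, hu⟩ := hg i
  let p : MvPolynomial σ ℂ := ∑ e ∈ s ∪ u, MvPolynomial.monomial e (MvPowerSeries.coeff e x)
  have hp : ∀ e ∈ s ∪ u, MvPowerSeries.coeff e x =
      MvPowerSeries.coeff e (p : MvPowerSeries σ ℂ) := by
    intro e he
    simp only [MvPolynomial.coeff_coe, p, MvPolynomial.coeff_sum, MvPolynomial.coeff_monomial,
      Finset.sum_ite_eq', he, if_true]
  refine (hs x p fun e he => hp e (Finset.mem_union_left _ he)).trans ?_
  refine Eq.trans ?_ (hu x p fun e he => hp e (Finset.mem_union_right _ he)).symm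
  beta_reduce
  rw [hpoly]

theorem isFinitary_schur_scaled {D : ℕ+ → Derivation ℂ (MvPowerSeries σ ℂ) (MvPowerSeries σ ℂ)}
    (hD : ∀ k l f, D k (D l f) = D l (D k f))
    (hfin : ∀ k d, IsFinitary fun f => MvPowerSeries.coeff d (D k f)) (n : ℕ) (d : σ →₀ ℕ) :
    IsFinitary fun f => MvPowerSeries.coeff d (schur (scaled D) (n : ℤ) f) := by
  induction n using Nat.strong_induction_on generalizing d with
  | _ n ih =>
    cases n with
    | zero =>
      simp only [Nat.cast_zero, schur_zero]
      exact isFinitary_coeff d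
    | succ n =>
      have hn : ((n + 1 : ℕ) : ℂ) ≠ 0 := Nat.cast_ne_zero.mpr (Nat.succ_ne_zero n)
      have h : ∀ f, MvPowerSeries.coeff d (schur (scaled D) ((n + 1 : ℕ) : ℤ) f) =
          ((n + 1 : ℕ) : ℂ)⁻¹ * ∑ p ∈ Finset.HasAntidiagonal.antidiagonal n,
            MvPowerSeries.coeff d (schur (scaled D) (p.1 : ℤ) (D p.2.succPNat f)) := by
        intro f
        rw [← map_sum, ← succ_smul_schur_scaled hD, MvPowerSeries.coeff_smul,
          inv_mul_cancel_left₀ hn]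
      simp only [h]
      refine (isFinitary_const _).op₂ (IsFinitary.sum _ fun p hp => ?_) (· * ·)
      have hlt : p.1 < n + 1 := by
        have := Finset.HasAntidiagonal.mem_antidiagonal.mp hp
        omega
      exact (ih p.1 hlt d).comp (hfin _)

/-- The algebra homomorphism `x ↦ f x + δ x ε` for a derivation `δ` along an algebra homomorphism
`f`. -/
def tangentHom {A B : Type*} [CommRing A] [Algebra ℂ A] [CommRing B] [Algebra ℂ B]
    (f : A →ₐ[ℂ] B) (δ : A →ₗ[ℂ] B) (hδ : ∀ x y, δ (x * y) = f x * δ y + f y * δ x) :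
    A →ₐ[ℂ] DualNumber B :=
  AlgHom.ofLinearMap
    { toFun := fun x => TrivSqZeroExt.inl (f x) + TrivSqZeroExt.inr (δ x)
      map_add' := fun x y => by ext <;> simp
      map_smul' := fun c x => by ext <;> simp }
    (by
      have h : δ 1 = 0 := by
        have h1 := hδ 1 1
        simpa using h1
      ext <;> simp [h])
    (fun x y => by ext <;> simp [hδ, mul_comm])

@[simp] theorem fst_tangentHom {A B : Type*} [CommRing A] [Algebra ℂ A] [CommRing B]
    [Algebra ℂ B] (f : A →ₐ[ℂ] B) (δ : A →ₗ[ℂ] B)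
    (hδ : ∀ x y, δ (x * y) = f x * δ y + f y * δ x) (x : A) :
    (tangentHom f δ hδ x).fst = f x := by
  simp [tangentHom]

@[simp] theorem snd_tangentHom {A B : Type*} [CommRing A] [Algebra ℂ A] [CommRing B]
    [Algebra ℂ B] (f : A →ₐ[ℂ] B) (δ : A →ₗ[ℂ] B)
    (hδ : ∀ x y, δ (x * y) = f x * δ y + f y * δ x) (x : A) :
    (tangentHom f δ hδ x).snd = δ x := by
  simp [tangentHom]

/-- Derivations along an algebra homomorphism which agree on the variables are equal. -/
theorem derivation_ext_of_isFinitary (f : MvPowerSeries σ ℂ →ₐ[ℂ] MvPowerSeries τ ℂ)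
    (hf : ∀ d, IsFinitary fun x => MvPowerSeries.coeff d (f x))
    {δ δ' : MvPowerSeries σ ℂ →ₗ[ℂ] MvPowerSeries τ ℂ}
    (hδ : ∀ x y, δ (x * y) = f x * δ y + f y * δ x)
    (hδ' : ∀ x y, δ' (x * y) = f x * δ' y + f y * δ' x)
    (hfin : ∀ d, IsFinitary fun x => MvPowerSeries.coeff d (δ x))
    (hfin' : ∀ d, IsFinitary fun x => MvPowerSeries.coeff d (δ' x))
    (hX : ∀ v, δ (MvPowerSeries.X v) = δ' (MvPowerSeries.X v)) (x : MvPowerSeries σ ℂ) :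
    δ x = δ' x := by
  let l : (τ →₀ ℕ) ⊕ (τ →₀ ℕ) → DualNumber (MvPowerSeries τ ℂ) → ℂ :=
    Sum.elim (fun d a => MvPowerSeries.coeff d a.fst) (fun d a => MvPowerSeries.coeff d a.snd)
  have h : tangentHom f δ hδ = tangentHom f δ' hδ' := by
    refine algHom_ext_of_isFinitary l ?_ ?_ ?_ ?_
    · intro a b hab
      refine TrivSqZeroExt.ext ?_ ?_
      · exact MvPowerSeries.ext fun d => hab (Sum.inl d)
      · exact MvPowerSeries.ext fun d => hab (Sum.inr d)
    · rintro (d | d)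
      · simpa [l] using hf d
      · simpa [l] using hfin d
    · rintro (d | d)
      · simpa [l] using hf d
      · simpa [l] using hfin' d
    · intro v
      ext <;> simp [hX]
  simpa using congrArg TrivSqZeroExt.snd (DFunLike.congr_fun h x)

theorem pderiv_comm (i j : σ) (f : MvPowerSeries σ ℂ) :
    MvPowerSeries.pderiv ℂ i (MvPowerSeries.pderiv ℂ j f) =
      MvPowerSeries.pderiv ℂ j (MvPowerSeries.pderiv ℂ i f) := by
  classical
  by_cases hij : i = j
  · rw [hij]
  · ext d
    simp only [MvPowerSeries.coeff_pderiv, Finsupp.add_apply, Finsupp.single_apply, hij,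
      Ne.symm hij, if_false, add_zero, add_right_comm d (Finsupp.single i 1)]
    ring

end Finitary

/-! ### The restriction to `s = -t` -/

section Restriction

theorem hasSubst_restrict : MvPowerSeries.HasSubst (timePoint (MvPowerSeries.X (R := ℂ) (σ := ℕ+))
    (-MvPowerSeries.X)) :=
  hasSubst_timePoint MvPowerSeries.HasSubst.X (hasSubst_neg MvPowerSeries.HasSubst.X)

/-- The restriction to `s = -t` as an algebra homomorphism. -/
def restrictHom : MvPowerSeries TSVar ℂ →ₐ[ℂ] MvPowerSeries ℕ+ ℂ :=
  MvPowerSeries.substAlgHom hasSubst_restrict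

theorem restrictHom_apply (f : MvPowerSeries TSVar ℂ) : restrictHom f = restrict f :=
  MvPowerSeries.substAlgHom_apply hasSubst_restrict f

theorem isFinitary_restrict (d : ℕ+ →₀ ℕ) :
    IsFinitary fun f => MvPowerSeries.coeff d (restrict f) :=
  isFinitary_subst hasSubst_restrict d

/-- The chain rule for `f(t, -t)`. -/
theorem pderiv_restrict (k : ℕ+) (f : MvPowerSeries TSVar ℂ) :
    MvPowerSeries.pderiv ℂ k (restrict f) =
      restrict (MvPowerSeries.pderiv ℂ (TSVar.t k) f) -
        restrict (MvPowerSeries.pderiv ℂ (TSVar.s k) f) := by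
  simp only [← restrictHom_apply]
  refine derivation_ext_of_isFinitary restrictHom (fun d => ?_)
    (δ := (MvPowerSeries.pderiv ℂ k).toLinearMap ∘ₗ restrictHom.toLinearMap)
    (δ' := restrictHom.toLinearMap ∘ₗ (MvPowerSeries.pderiv ℂ (TSVar.t k)).toLinearMap -
      restrictHom.toLinearMap ∘ₗ (MvPowerSeries.pderiv ℂ (TSVar.s k)).toLinearMap)
    (fun x y => ?_) (fun x y => ?_) (fun d => ?_) (fun d => ?_) (fun v => ?_) f
  · simpa only [restrictHom_apply] using isFinitary_restrict d
  · simp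
  · simp
    ring
  · simp only [LinearMap.comp_apply, Derivation.coeFn_coe, AlgHom.toLinearMap_apply,
      restrictHom_apply]
    exact (isFinitary_pderiv k d).comp isFinitary_restrict
  · simp only [LinearMap.comp_apply, LinearMap.sub_apply, map_sub, Derivation.coeFn_coe,
      AlgHom.toLinearMap_apply, restrictHom_apply]
    exact ((isFinitary_restrict d).comp (isFinitary_pderiv _)).op₂
      ((isFinitary_restrict d).comp (isFinitary_pderiv _)) (· - ·)
  · have hX : ∀ v, restrictHom (MvPowerSeries.X v) =
        timePoint MvPowerSeries.X (-MvPowerSeries.X) v :=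
      MvPowerSeries.substAlgHom_X hasSubst_restrict
    simp only [LinearMap.comp_apply, LinearMap.sub_apply, Derivation.coeFn_coe,
      AlgHom.toLinearMap_apply, hX]
    rcases v with (i | i) <;> by_cases h : i = k <;>
      simp [timePoint, MvPowerSeries.pderiv_X_of_ne, h]

end Restriction

/-! ### Taylor series of shifted sequences -/

section ShiftedSequences

variable {R : Type*} [CommRing R] [Algebra ℂ R]

/-- If `Dₖ` acts on the double sequence `y` as `-(Λᵏ y + y (Λᵀ)ᵏ)`, then the Taylor series of `y`
is `(1 - z Λ) y (1 - z Λᵀ)`, since `exp (- ∑ zᵏ Λᵏ / k) = 1 - z Λ`. -/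
theorem schurHom_eq_rowShift_colShift {D : ℕ+ → Derivation ℂ R R}
    (hD : ∀ k l f, D k (D l f) = D l (D k f)) {y : ℕ → ℕ → R}
    (hy : ∀ k i j, D k (y i j) = -y (i + k) j - y i (j + k)) (i j : ℕ) :
    schurHom hD (y i j) = rowShift PowerSeries.X
      (colShift PowerSeries.X fun i j => PowerSeries.C (y i j)) i j := by
  let q : ℕ → ℕ × ℕ → R
    | 0, i => y i.1 i.2
    | 1, i => -y (i.1 + 1) i.2 - y i.1 (i.2 + 1)
    | 2, i => y (i.1 + 1) (i.2 + 1)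
    | _ + 3, _ => 0
  have hq := schur_scaled_eq hD (fun i : ℕ × ℕ => y i.1 i.2) q (fun i => rfl) (by
    rintro n ⟨i, j⟩ ih
    have hterm : ∀ p ∈ Finset.HasAntidiagonal.antidiagonal n,
        schur (scaled D) (p.1 : ℤ) (D p.2.succPNat (y i j)) =
          -q p.1 (i + (p.2 + 1), j) - q p.1 (i, j + (p.2 + 1)) := by
      intro p hp
      have hle : p.1 ≤ n := by
        have := Finset.HasAntidiagonal.mem_antidiagonal.mp hp
        omega
      rw [hy, map_sub, map_neg]
      exact congrArg₂ (fun a b => -a - b) (ih p.1 hle (i + (p.2 + 1), j))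
        (ih p.1 hle (i, j + (p.2 + 1)))
    rw [Finset.sum_congr rfl hterm]
    rcases n with _ | _ | n
    · simp [q]
    · rw [Finset.Nat.sum_antidiagonal_succ]
      simp only [q, zero_add, Finset.Nat.antidiagonal_zero, Finset.sum_singleton, add_assoc,
        Nat.reduceAdd, Nat.cast_ofNat, ofNat_smul_eq_nsmul, nsmul_eq_mul]
      ring_nf
    · rw [Finset.Nat.sum_antidiagonal_succ, Finset.Nat.sum_antidiagonal_succ,
        Finset.sum_eq_single (0, n)]
      · simp only [q, zero_add, smul_zero]
        ring_nf
      · rintro ⟨a, b⟩ hp hne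
        rcases a with _ | a
        · simp_all
        · simp [q]
      · simp)
  ext n
  rw [coeff_schurHom, hq n (i, j)]
  simp only [rowShift, colShift, mul_sub, map_sub]
  rcases n with _ | _ | _ | n
  · simp [q]
  · simp [q, PowerSeries.coeff_succ_X_mul]
    ring
  · simp [q, PowerSeries.coeff_succ_X_mul, PowerSeries.coeff_X]
  · simp [q, PowerSeries.coeff_succ_X_mul, PowerSeries.coeff_X]

/-- The analogue of `schurHom_eq_rowShift_colShift` for sequences with one index. -/
theorem schurHom_eq_sub {D : ℕ+ → Derivation ℂ R R}
    (hD : ∀ k l f, D k (D l f) = D l (D k f)) {x : ℕ → R}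
    (hx : ∀ k i, D k (x i) = -x (i + k)) (i : ℕ) :
    schurHom hD (x i) = PowerSeries.C (x i) - PowerSeries.X * PowerSeries.C (x (i + 1)) := by
  have h := schurHom_eq_rowShift_colShift hD (y := fun i j => if j = 0 then x i else 0)
    (fun k i j => by
      by_cases hj : j = 0 <;> simp [hj, hx, k.ne_zero]) i 0
  simpa [rowShift, colShift] using h

/-- The map `∑ f_b(t) w ^ b ↦ ∑ f_b(t + [z]) z ^ b`. -/
def schurDiag (D : ℕ+ → Derivation ℂ R R) : PowerSeries R →ₗ[ℂ] PowerSeries R where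
  toFun G := PowerSeries.mk fun n => ∑ p ∈ Finset.HasAntidiagonal.antidiagonal n,
    schur (scaled D) (p.1 : ℤ) (PowerSeries.coeff p.2 G)
  map_add' F G := by
    ext n
    simp [Finset.sum_add_distrib]
  map_smul' a G := by
    ext n
    simp [Finset.smul_sum]

theorem coeff_schurDiag (D : ℕ+ → Derivation ℂ R R) (G : PowerSeries R) (n : ℕ) :
    PowerSeries.coeff n (schurDiag D G) = ∑ p ∈ Finset.HasAntidiagonal.antidiagonal n,
      schur (scaled D) (p.1 : ℤ) (PowerSeries.coeff p.2 G) := by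
  simp [schurDiag]

theorem schurDiag_C {D : ℕ+ → Derivation ℂ R R} (hD : ∀ k l f, D k (D l f) = D l (D k f))
    (f : R) : schurDiag D (PowerSeries.C f) = schurHom hD f := by
  ext n
  rw [coeff_schurDiag, coeff_schurHom, Finset.sum_eq_single (n, 0)]
  · simp
  · rintro ⟨a, b⟩ hp hne
    have hb : b ≠ 0 := by
      rintro rfl
      simp_all
    simp [PowerSeries.coeff_C, hb]
  · simp

theorem schurDiag_X_mul (D : ℕ+ → Derivation ℂ R R) (G : PowerSeries R) :
    schurDiag D (PowerSeries.X * G) = PowerSeries.X * schurDiag D G := by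
  ext n
  cases n with
  | zero => simp [coeff_schurDiag]
  | succ n =>
    rw [PowerSeries.coeff_succ_X_mul, coeff_schurDiag, coeff_schurDiag,
      Finset.Nat.sum_antidiagonal_succ']
    simp [PowerSeries.coeff_succ_X_mul]

/-- `f(t - [w] + [z])` is `f(t)` at `w = z`. -/
theorem schurDiag_schurHom_neg {D : ℕ+ → Derivation ℂ R R}
    (hD : ∀ k l f, D k (D l f) = D l (D k f))
    (hD' : ∀ k l f, (-D) k ((-D) l f) = (-D) l ((-D) k f)) (f : R) :
    schurDiag D (schurHom hD' f) = PowerSeries.C f := by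
  ext n
  rw [coeff_schurDiag]
  simp only [coeff_schurHom]
  rw [sum_schur_scaled_schur_scaled_neg hD, PowerSeries.coeff_C]

/-- If `Dₖ` acts on `y` as `Λᵏ y + y (Λᵀ)ᵏ`, then the Taylor series of `y` is
`(1 - z Λ)⁻¹ y (1 - z Λᵀ)⁻¹`. -/
theorem rowShift_colShift_schurHom {D : ℕ+ → Derivation ℂ R R}
    (hD : ∀ k l f, D k (D l f) = D l (D k f))
    (hD' : ∀ k l f, (-D) k ((-D) l f) = (-D) l ((-D) k f)) {y : ℕ → ℕ → R}
    (hy : ∀ k i j, D k (y i j) = y (i + k) j + y i (j + k)) (i j : ℕ) :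
    rowShift PowerSeries.X (colShift PowerSeries.X fun i j => schurHom hD (y i j)) i j =
      PowerSeries.C (y i j) := by
  rw [← schurDiag_schurHom_neg hD hD', schurHom_eq_rowShift_colShift hD' (y := y)
    (fun k i j => by rw [Pi.neg_apply, Derivation.neg_apply, hy]; ring)]
  simp only [rowShift, colShift, mul_sub, map_sub, schurDiag_X_mul, schurDiag_C hD]

/-- The analogue of `rowShift_colShift_schurHom` for sequences with one index. -/
theorem sub_X_mul_schurHom {D : ℕ+ → Derivation ℂ R R}
    (hD : ∀ k l f, D k (D l f) = D l (D k f))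
    (hD' : ∀ k l f, (-D) k ((-D) l f) = (-D) l ((-D) k f)) {x : ℕ → R}
    (hx : ∀ k i, D k (x i) = x (i + k)) (i : ℕ) :
    schurHom hD (x i) - PowerSeries.X * schurHom hD (x (i + 1)) = PowerSeries.C (x i) := by
  rw [← schurDiag_schurHom_neg hD hD', schurHom_eq_sub hD' (x := x)
    (fun k i => by rw [Pi.neg_apply, Derivation.neg_apply, hx])]
  simp only [map_sub, schurDiag_X_mul, schurDiag_C hD]

/-- The operator `1 - z Λ` is injective. -/
theorem eq_of_sub_X_mul_eq {R : Type*} [CommRing R] {x y : ℕ → PowerSeries R}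
    (h : ∀ i, x i - PowerSeries.X * x (i + 1) = y i - PowerSeries.X * y (i + 1)) (i : ℕ) :
    x i = y i := by
  have hcoeff : ∀ n i, PowerSeries.coeff n (x i) = PowerSeries.coeff n (y i) := by
    intro n
    induction n with
    | zero =>
      intro i
      simpa using congrArg (PowerSeries.coeff 0) (h i)
    | succ n ih =>
      intro i
      have hi := congrArg (PowerSeries.coeff (n + 1)) (h i)
      simpa [PowerSeries.coeff_succ_X_mul, ih (i + 1)] using hi
  exact PowerSeries.ext fun n => hcoeff n i

end ShiftedSequences

/-! ### The moment matrix and the derivatives of the tau functions -/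

section Moments

/-- The derivatives with respect to `t₁, t₂, …` on power series in `(t, s)`. -/
def derivTS (k : ℕ+) : Derivation ℂ (MvPowerSeries TSVar ℂ) (MvPowerSeries TSVar ℂ) :=
  MvPowerSeries.pderiv ℂ (TSVar.t k)

/-- The derivatives with respect to `t₁, t₂, …` on power series in `t`. -/
def derivT (k : ℕ+) : Derivation ℂ (MvPowerSeries ℕ+ ℂ) (MvPowerSeries ℕ+ ℂ) :=
  MvPowerSeries.pderiv ℂ k

theorem derivTS_comm (k l : ℕ+) (f : MvPowerSeries TSVar ℂ) :
    derivTS k (derivTS l f) = derivTS l (derivTS k f) :=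
  pderiv_comm _ _ f

theorem derivT_comm (k l : ℕ+) (f : MvPowerSeries ℕ+ ℂ) :
    derivT k (derivT l f) = derivT l (derivT k f) :=
  pderiv_comm _ _ f

theorem neg_derivTS_comm (k l : ℕ+) (f : MvPowerSeries TSVar ℂ) :
    (-derivTS) k ((-derivTS) l f) = (-derivTS) l ((-derivTS) k f) := by
  simp [derivTS_comm k l]

theorem neg_derivT_comm (k l : ℕ+) (f : MvPowerSeries ℕ+ ℂ) :
    (-derivT) k ((-derivT) l f) = (-derivT) l ((-derivT) k f) := by
  simp [derivT_comm k l]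

theorem scaled_derivTS : scaled derivTS = scaledTS := rfl

theorem scaled_derivT : scaled derivT = scaledT := rfl

theorem scaled_neg_derivTS : scaled (-derivTS) = -scaledTS := scaled_neg _

theorem scaled_neg_derivT : scaled (-derivT) = -scaledT := scaled_neg _

/-- The entries of the moment matrix `m(t, -t)`. -/
def symMoment (c : Matrix ℕ ℕ ℂ) (i j : ℕ) : MvPowerSeries ℕ+ ℂ := restrict (moment c i j)

theorem tau_eq_leadingMinor (c : Matrix ℕ ℕ ℂ) (m : ℕ) : tau c m = leadingMinor m (moment c) :=
  rfl

theorem symTau_eq_leadingMinor (c : Matrix ℕ ℕ ℂ) (m : ℕ) :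
    symTau c m = leadingMinor m (symMoment c) := by
  rw [symTau, ← restrictHom_apply, tau_eq_leadingMinor]
  refine (map_leadingMinor restrictHom m (moment c)).trans ?_
  exact leadingMinor_congr fun i _ j _ => restrictHom_apply _

theorem derivT_symMoment (c : Matrix ℕ ℕ ℂ) (k : ℕ+) (i j : ℕ) :
    derivT k (symMoment c i j) = symMoment c (i + k) j + symMoment c i (j + k) := by
  rw [derivT, symMoment, pderiv_restrict, pderiv_t_moment, pderiv_s_moment]
  simp only [← restrictHom_apply, map_neg, sub_neg_eq_add, symMoment]

theorem constantCoeff_restrict (f : MvPowerSeries TSVar ℂ) :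
    MvPowerSeries.constantCoeff (restrict f) = MvPowerSeries.constantCoeff f := by
  have h : restrict f = restrict (f - MvPowerSeries.C (MvPowerSeries.constantCoeff f)) +
      MvPowerSeries.C (MvPowerSeries.constantCoeff f) := by
    have hC : restrictHom (MvPowerSeries.C (MvPowerSeries.constantCoeff f)) =
        MvPowerSeries.C (MvPowerSeries.constantCoeff f) := by
      exact AlgHom.commutes restrictHom _
    simp only [← restrictHom_apply, map_sub, hC, sub_add_cancel]
  rw [h, map_add, MvPowerSeries.constantCoeff_C]
  have h0 : MvPowerSeries.constantCoeff
      (restrict (f - MvPowerSeries.C (MvPowerSeries.constantCoeff f))) = 0 := by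
    refine MvPowerSeries.constantCoeff_subst_eq_zero hasSubst_restrict ?_ (by simp)
    rintro (k | k) <;> simp [timePoint]
  rw [h0, zero_add]

/-- For symmetric `c` the matrix `m(t, -t)` is symmetric: its entries and their transposes satisfy
the same differential equations with the same initial values. -/
theorem symMoment_comm {c : Matrix ℕ ℕ ℂ} (hc : c.IsSymm) (i j : ℕ) :
    symMoment c i j = symMoment c j i := by
  classical
  suffices h : ∀ (n : ℕ) (d : ℕ+ →₀ ℕ), d.degree = n → ∀ i j,
      MvPowerSeries.coeff d (symMoment c i j) = MvPowerSeries.coeff d (symMoment c j i) from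
    MvPowerSeries.ext fun d => h _ d rfl i j
  intro n
  induction n with
  | zero =>
    intro d hd i j
    obtain rfl : d = 0 := (Finsupp.degree_eq_zero_iff d).mp hd
    simp only [MvPowerSeries.coeff_zero_eq_constantCoeff_apply, symMoment,
      constantCoeff_restrict, constantCoeff_moment]
    exact hc.apply j i
  | succ n ih =>
    intro d hd i j
    obtain ⟨k, hk⟩ : ∃ k, d k ≠ 0 := by
      by_contra! h
      have : d = 0 := Finsupp.ext h
      simp [this] at hd
    obtain ⟨e, rfl⟩ : ∃ e, d = e + Finsupp.single k 1 :=
      ⟨d - Finsupp.single k 1, (tsub_add_cancel_of_le (by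
        rw [Finsupp.single_le_iff]; exact Nat.one_le_iff_ne_zero.mpr hk)).symm⟩
    have he : e.degree = n := by
      rw [map_add, Finsupp.degree_single] at hd
      omega
    have hcoeff : ∀ i j, MvPowerSeries.coeff (e + Finsupp.single k 1) (symMoment c i j) *
        ((e k : ℂ) + 1) = MvPowerSeries.coeff e (symMoment c (i + k) j) +
          MvPowerSeries.coeff e (symMoment c i (j + k)) := by
      intro i j
      rw [← MvPowerSeries.coeff_pderiv, ← map_add, ← derivT_symMoment]
      rfl
    have hne : ((e k : ℂ) + 1) ≠ 0 := Nat.cast_add_one_ne_zero (e k)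
    refine mul_right_cancel₀ hne ?_
    rw [hcoeff, hcoeff, ih e he (i + k) j, ih e he i (j + k), add_comm]

/-- For symmetric `c` the derivatives of `τₘ` along `tₖ` and along `-sₖ` agree at `s = -t`, because
the corresponding first-order deformations of `m(t, -t)` are transposes of each other. -/
theorem restrict_pderiv_s_tau {c : Matrix ℕ ℕ ℂ} (hc : c.IsSymm) (m : ℕ) (k : ℕ+) :
    restrict (MvPowerSeries.pderiv ℂ (TSVar.s k) (tau c m)) =
      -restrict (MvPowerSeries.pderiv ℂ (TSVar.t k) (tau c m)) := by
  let f := tangentHom restrictHom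
    (restrictHom.toLinearMap ∘ₗ (MvPowerSeries.pderiv ℂ (TSVar.t k)).toLinearMap)
    (fun x y => by simp)
  let g := tangentHom restrictHom
    (-(restrictHom.toLinearMap ∘ₗ (MvPowerSeries.pderiv ℂ (TSVar.s k)).toLinearMap))
    (fun x y => by simp; ring)
  have hf1 : ∀ x, (f x).fst = restrict x := fun x =>
    (fst_tangentHom _ _ _ x).trans (restrictHom_apply x)
  have hf2 : ∀ x, (f x).snd = restrict (MvPowerSeries.pderiv ℂ (TSVar.t k) x) := fun x =>
    (snd_tangentHom _ _ _ x).trans (restrictHom_apply _)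
  have hg1 : ∀ x, (g x).fst = restrict x := fun x =>
    (fst_tangentHom _ _ _ x).trans (restrictHom_apply x)
  have hg2 : ∀ x, (g x).snd = -restrict (MvPowerSeries.pderiv ℂ (TSVar.s k) x) := fun x =>
    (snd_tangentHom _ _ _ x).trans (congrArg Neg.neg (restrictHom_apply _))
  have hfg : ∀ i j, g (moment c i j) = f (moment c j i) := by
    intro i j
    refine TrivSqZeroExt.ext ?_ ?_
    · rw [hg1, hf1]
      exact symMoment_comm hc i j
    · rw [hg2, hf2, pderiv_s_moment, pderiv_t_moment, ← restrictHom_apply, map_neg, neg_neg,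
        restrictHom_apply]
      exact symMoment_comm hc i (j + k)
  have h : g (tau c m) = f (tau c m) := by
    rw [tau_eq_leadingMinor]
    refine (map_leadingMinor g m (moment c)).trans ?_
    refine Eq.trans ?_ (map_leadingMinor f m (moment c)).symm
    rw [← leadingMinor_swap]
    exact leadingMinor_congr fun i _ j _ => hfg j i
  have h2 := congrArg TrivSqZeroExt.snd h
  rw [hg2, hf2] at h2
  rw [← h2, neg_neg]

theorem restrict_dTS_tau {c : Matrix ℕ ℕ ℂ} (hc : c.IsSymm) (m : ℕ) (k : ℕ+) :
    restrict (dTS k (tau c m)) = (1 / 2 : ℂ) • dT k (symTau c m) := by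
  have h : dT k (symTau c m) = restrict (dTS k (tau c m)) + restrict (dTS k (tau c m)) := by
    refine (pderiv_restrict k (tau c m)).trans ?_
    rw [restrict_pderiv_s_tau hc, sub_neg_eq_add]
    rfl
  rw [h, ← two_smul ℂ, smul_smul]
  norm_num

theorem isUnit_symTau {c : Matrix ℕ ℕ ℂ} {m : ℕ}
    (h : (Matrix.of fun i j : Fin m => c i j).det ≠ 0) : IsUnit (symTau c m) := by
  rw [MvPowerSeries.isUnit_iff_constantCoeff, symTau_eq_leadingMinor, map_leadingMinor]
  simp only [symMoment, constantCoeff_restrict, constantCoeff_moment]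
  exact isUnit_iff_ne_zero.mpr h

end Moments

/-! ### The generating identity -/

section Generating

/-- The embedding of the constant power series as an algebra homomorphism. -/
def constHom (A : Type*) [CommRing A] [Algebra ℂ A] : A →ₐ[ℂ] PowerSeries A :=
  { PowerSeries.C with commutes' := fun _ => (PowerSeries.algebraMap_apply).symm }

@[simp] theorem constHom_apply {A : Type*} [CommRing A] [Algebra ℂ A] (a : A) :
    constHom A a = PowerSeries.C a := rfl

/-- The Taylor series of `f(t) ↦ f(t + [α])`, a power series in `β` that is constant.  In this and the
following definitions `α` is the inner and `β` the outer variable of `ℂ⟦t⟧⟦α⟧⟦β⟧`. -/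
def shiftUp : MvPowerSeries ℕ+ ℂ →ₐ[ℂ] PowerSeries (PowerSeries (MvPowerSeries ℕ+ ℂ)) :=
  (constHom _).comp (schurHom derivT_comm)

/-- The Taylor series of `f(t) ↦ f(t - [β])`. -/
def shiftDown : MvPowerSeries ℕ+ ℂ →ₐ[ℂ] PowerSeries (PowerSeries (MvPowerSeries ℕ+ ℂ)) :=
  (PowerSeries.mapAlgHom (constHom _)).comp (schurHom neg_derivT_comm)

/-- The Taylor series of `f(t) ↦ f(t + [α] - [β])`. -/
def shiftBoth : MvPowerSeries ℕ+ ℂ →ₐ[ℂ] PowerSeries (PowerSeries (MvPowerSeries ℕ+ ℂ)) :=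
  (PowerSeries.mapAlgHom (schurHom derivT_comm)).comp (schurHom neg_derivT_comm)

/-- The Taylor series of `f(t, s) ↦ f(t + [α] - [β], -t)`. -/
def shiftRestrict : MvPowerSeries TSVar ℂ →ₐ[ℂ] PowerSeries (PowerSeries (MvPowerSeries ℕ+ ℂ)) :=
  ((PowerSeries.mapAlgHom (PowerSeries.mapAlgHom restrictHom)).comp
    (PowerSeries.mapAlgHom (schurHom derivTS_comm))).comp (schurHom neg_derivTS_comm)

theorem coeff_coeff_shiftUp (i j : ℕ) (f : MvPowerSeries ℕ+ ℂ) :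
    PowerSeries.coeff i (PowerSeries.coeff j (shiftUp f)) =
      if j = 0 then schur scaledT (i : ℤ) f else 0 := by
  simp only [shiftUp, AlgHom.comp_apply, constHom_apply, PowerSeries.coeff_C]
  split_ifs
  · rw [coeff_schurHom, scaled_derivT]
  · simp

theorem coeff_coeff_shiftDown (i j : ℕ) (f : MvPowerSeries ℕ+ ℂ) :
    PowerSeries.coeff i (PowerSeries.coeff j (shiftDown f)) =
      if i = 0 then schur (-scaledT) (j : ℤ) f else 0 := by
  simp only [shiftDown, AlgHom.comp_apply, PowerSeries.mapAlgHom_apply, PowerSeries.coeff_map,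
    coeff_schurHom, scaled_neg_derivT]
  exact PowerSeries.coeff_C i _

theorem coeff_coeff_shiftBoth (i j : ℕ) (f : MvPowerSeries ℕ+ ℂ) :
    PowerSeries.coeff i (PowerSeries.coeff j (shiftBoth f)) =
      schur scaledT (i : ℤ) (schur (-scaledT) (j : ℤ) f) := by
  simp only [shiftBoth, AlgHom.comp_apply, PowerSeries.mapAlgHom_apply, PowerSeries.coeff_map,
    coeff_schurHom, scaled_neg_derivT]
  rw [RingHom.coe_coe, coeff_schurHom, scaled_derivT]

theorem coeff_coeff_shiftRestrict (i j : ℕ) (f : MvPowerSeries TSVar ℂ) :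
    PowerSeries.coeff i (PowerSeries.coeff j (shiftRestrict f)) =
      restrict (schur scaledTS (i : ℤ) (schur (-scaledTS) (j : ℤ) f)) := by
  simp only [shiftRestrict, AlgHom.comp_apply, PowerSeries.mapAlgHom_apply, PowerSeries.coeff_map,
    coeff_schurHom, scaled_neg_derivTS, RingHom.coe_coe, scaled_derivTS, restrictHom_apply]

/-- `m̃(t + [α] - [β]) = (1 - β Λ) m̃(t + [α]) (1 - β Λᵀ)` for `m̃(t) = m(t, -t)`. -/
theorem shiftBoth_symMoment (c : Matrix ℕ ℕ ℂ) (i j : ℕ) :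
    shiftBoth (symMoment c i j) = rowShift PowerSeries.X
      (colShift PowerSeries.X fun i j => shiftUp (symMoment c i j)) i j := by
  simp only [shiftBoth, shiftUp, AlgHom.comp_apply]
  rw [schurHom_eq_rowShift_colShift neg_derivT_comm (y := symMoment c)
    (fun k i j => by rw [Pi.neg_apply, Derivation.neg_apply, derivT_symMoment]; ring)]
  simp [rowShift, colShift, PowerSeries.mapAlgHom_apply]

/-- `m̃(t - [β]) = (1 - β Λ) m̃(t) (1 - β Λᵀ)` for `m̃(t) = m(t, -t)`. -/
theorem shiftDown_symMoment (c : Matrix ℕ ℕ ℂ) (i j : ℕ) :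
    shiftDown (symMoment c i j) = rowShift PowerSeries.X (colShift PowerSeries.X fun i j =>
      PowerSeries.C (PowerSeries.C (symMoment c i j))) i j := by
  simp only [shiftDown, AlgHom.comp_apply]
  rw [schurHom_eq_rowShift_colShift neg_derivT_comm (y := symMoment c)
    (fun k i j => by rw [Pi.neg_apply, Derivation.neg_apply, derivT_symMoment]; ring)]
  simp [rowShift, colShift, PowerSeries.mapAlgHom_apply]

/-- `(1 - α Λ) m̃(t + [α]) (1 - α Λᵀ) = m̃(t)` for `m̃(t) = m(t, -t)`. -/
theorem rowShift_colShift_shiftUp_symMoment (c : Matrix ℕ ℕ ℂ) :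
    rowShift (PowerSeries.C PowerSeries.X) (colShift (PowerSeries.C PowerSeries.X) fun i j =>
      shiftUp (symMoment c i j)) = fun i j => PowerSeries.C (PowerSeries.C (symMoment c i j)) := by
  ext1 i
  ext1 j
  rw [← rowShift_colShift_schurHom derivT_comm neg_derivT_comm (y := symMoment c)
    (derivT_symMoment c)]
  simp [rowShift, colShift, shiftUp]

/-- `m(t + [α], -t) = m(t + [α], -t - [α]) (1 - α Λᵀ)`; both sides become `m(t, -t)` after
multiplication by `1 - α Λ` on the left. -/
theorem map_restrictHom_schurHom_moment (c : Matrix ℕ ℕ ℂ) (i j : ℕ) :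
    PowerSeries.mapAlgHom restrictHom (schurHom derivTS_comm (moment c i j)) =
      colShift PowerSeries.X (fun i j => schurHom derivT_comm (symMoment c i j)) i j := by
  refine eq_of_sub_X_mul_eq (x := fun i => PowerSeries.mapAlgHom restrictHom
    (schurHom derivTS_comm (moment c i j))) (y := fun i =>
      colShift PowerSeries.X (fun i j => schurHom derivT_comm (symMoment c i j)) i j)
    (fun i => ?_) i
  have h1 := congrArg (PowerSeries.mapAlgHom restrictHom)
    (sub_X_mul_schurHom derivTS_comm neg_derivTS_comm (x := fun i => moment c i j)
      (fun k i => pderiv_t_moment c k i j) i)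
  have h2 := rowShift_colShift_schurHom derivT_comm neg_derivT_comm (y := symMoment c)
    (derivT_symMoment c) i j
  refine Eq.trans ?_ (h1.trans (Eq.trans ?_ h2.symm))
  · rw [map_sub, map_mul]
    simp [PowerSeries.mapAlgHom_apply]
  · simp [PowerSeries.mapAlgHom_apply, restrictHom_apply, symMoment]

/-- `m(t + [α] - [β], -t) = (1 - β Λ) m(t + [α], -t - [α]) (1 - α Λᵀ)`. -/
theorem shiftRestrict_moment (c : Matrix ℕ ℕ ℂ) (i j : ℕ) :
    shiftRestrict (moment c i j) = rowShift PowerSeries.X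
      (colShift (PowerSeries.C PowerSeries.X) fun i j => shiftUp (symMoment c i j)) i j := by
  simp only [shiftRestrict, AlgHom.comp_apply]
  rw [schurHom_eq_sub neg_derivTS_comm (x := fun i => moment c i j)
    (fun k i => congrArg Neg.neg (pderiv_t_moment c k i j))]
  have hC : ∀ i, PowerSeries.mapAlgHom (PowerSeries.mapAlgHom restrictHom)
      (PowerSeries.mapAlgHom (schurHom derivTS_comm) (PowerSeries.C (moment c i j))) =
      PowerSeries.C (PowerSeries.mapAlgHom restrictHom
        (schurHom derivTS_comm (moment c i j))) := by
    intro i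
    simp [PowerSeries.mapAlgHom_apply]
  have hX : PowerSeries.mapAlgHom (PowerSeries.mapAlgHom restrictHom)
      (PowerSeries.mapAlgHom (schurHom derivTS_comm) PowerSeries.X) = PowerSeries.X := by
    simp [PowerSeries.mapAlgHom_apply]
  simp only [map_sub, map_mul, hC, hX, map_restrictHom_schurHom_moment]
  simp [rowShift, colShift, shiftUp]

/-- The relation between the symmetric and the 2d-Toda tau functions, with the Miwa shifts written
as Taylor series in `α = C X` and `β = X`.  It is `leadingMinor_shift_identity_of_symm` for the
matrix `m(t + [α], -t - [α])`. -/
theorem generating_identity {c : Matrix ℕ ℕ ℂ} (hc : c.IsSymm) (n : ℕ) :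
    PowerSeries.C (PowerSeries.C (symTau c (n + 1))) * shiftBoth (symTau c (n + 1)) -
      (PowerSeries.X - PowerSeries.C PowerSeries.X) ^ 2 * shiftDown (symTau c n) *
        shiftUp (symTau c (n + 2)) = shiftRestrict (tau c (n + 1)) ^ 2 := by
  have : IsDomain (MvPowerSeries ℕ+ ℂ) := NoZeroDivisors.to_isDomain _
  have h := leadingMinor_shift_identity_of_symm n (PowerSeries.C PowerSeries.X) PowerSeries.X
    (N := fun i j => shiftUp (symMoment c i j)) (fun i j => by rw [symMoment_comm hc])
  rw [rowShift_colShift_shiftUp_symMoment] at h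
  have hconst : ∀ f : MvPowerSeries ℕ+ ℂ, PowerSeries.C (PowerSeries.C f) =
      ((constHom _).comp (constHom _)) f := fun _ => rfl
  simp only [hconst, tau_eq_leadingMinor, symTau_eq_leadingMinor, map_leadingMinor, shiftBoth_symMoment,
    shiftDown_symMoment, shiftRestrict_moment] at h ⊢
  exact h

end Generating

/-! ### The bilinear relations -/

section Bilinear

theorem schur_natCast_sub {A : Type*} [Ring A] [Algebra ℂ A] (x : ℕ+ → A) (n r : ℕ) :
    schur x ((n : ℤ) - r) = if r ≤ n then schur x ((n - r : ℕ) : ℤ) else 0 := by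
  split_ifs with h
  · rw [Nat.cast_sub h]
  · obtain ⟨k, hk⟩ : ∃ k : ℕ, (n : ℤ) - r = Int.negSucc k := ⟨r - n - 1, by omega⟩
    rw [hk]
    rfl

/-- The coefficients of `βᵇ αᵃ f(t - [β]) g(t + [α])`; those below the powers `βᵇ` and `αᵃ` are the
vanishing Schur polynomials of negative index. -/
theorem coeff_coeff_shiftDown_mul_shiftUp (i j a b : ℕ) (f g : MvPowerSeries ℕ+ ℂ) :
    PowerSeries.coeff i (PowerSeries.coeff j (PowerSeries.X ^ b *
      (PowerSeries.C (PowerSeries.X ^ a) * (shiftDown f * shiftUp g)))) =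
      schur (-scaledT) ((j : ℤ) - b) f * schur scaledT ((i : ℤ) - a) g := by
  have hbase : ∀ i j : ℕ, PowerSeries.coeff i (PowerSeries.coeff j (shiftDown f * shiftUp g)) =
      schur (-scaledT) (j : ℤ) f * schur scaledT (i : ℤ) g := by
    intro i j
    have hdown : PowerSeries.coeff j (shiftDown f) =
        PowerSeries.C (schur (-scaledT) (j : ℤ) f) := by
      ext1 n
      rw [coeff_coeff_shiftDown, PowerSeries.coeff_C]
    have hup : shiftUp g = PowerSeries.C (schurHom derivT_comm g) := rfl
    rw [hup, PowerSeries.coeff_mul_C, hdown, PowerSeries.coeff_C_mul, coeff_schurHom,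
      scaled_derivT]
  rw [schur_natCast_sub, schur_natCast_sub, PowerSeries.coeff_X_pow_mul']
  split_ifs with h1 h2
  · rw [PowerSeries.coeff_C_mul, PowerSeries.coeff_X_pow_mul', if_pos h2, hbase]
  · rw [PowerSeries.coeff_C_mul, PowerSeries.coeff_X_pow_mul', if_neg h2, LinearMap.zero_apply,
      mul_zero]
  · rw [map_zero, LinearMap.zero_apply, zero_mul]
  · rw [map_zero, LinearMap.zero_apply, zero_mul]

/-- The coefficient of `αⁱ βʲ` in `generating_identity`. -/
theorem bilinear_relation {c : Matrix ℕ ℕ ℂ} (hc : c.IsSymm) (n i j : ℕ) :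
    ∑ k ∈ Finset.range (i + 1), ∑ l ∈ Finset.range (j + 1),
        restrict (schur scaledTS k (schur (-scaledTS) l (tau c (n + 1))))
          * restrict (schur scaledTS ((i : ℤ) - k)
              (schur (-scaledTS) ((j : ℤ) - l) (tau c (n + 1))))
      = symTau c (n + 1) * schur scaledT i (schur (-scaledT) j (symTau c (n + 1)))
        - schur (-scaledT) j (symTau c n) * schur scaledT ((i : ℤ) - 2) (symTau c (n + 2))
        + 2 * (schur (-scaledT) ((j : ℤ) - 1) (symTau c n)
            * schur scaledT ((i : ℤ) - 1) (symTau c (n + 2)))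
        - schur (-scaledT) ((j : ℤ) - 2) (symTau c n)
            * schur scaledT i (symTau c (n + 2)) := by
  have h := congrArg (fun F => PowerSeries.coeff i (PowerSeries.coeff j F))
    (generating_identity hc n)
  have hsq : (PowerSeries.X - PowerSeries.C PowerSeries.X) ^ 2 * shiftDown (symTau c n) *
      shiftUp (symTau c (n + 2)) =
      PowerSeries.X ^ 2 * (PowerSeries.C (PowerSeries.X ^ 0) *
          (shiftDown (symTau c n) * shiftUp (symTau c (n + 2)))) -
        (PowerSeries.X ^ 1 * (PowerSeries.C (PowerSeries.X ^ 1) *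
          (shiftDown (symTau c n) * shiftUp (symTau c (n + 2)))) +
        PowerSeries.X ^ 1 * (PowerSeries.C (PowerSeries.X ^ 1) *
          (shiftDown (symTau c n) * shiftUp (symTau c (n + 2))))) +
        PowerSeries.X ^ 0 * (PowerSeries.C (PowerSeries.X ^ 2) *
          (shiftDown (symTau c n) * shiftUp (symTau c (n + 2)))) := by
    simp only [map_pow]
    ring
  have hlhs : PowerSeries.coeff i (PowerSeries.coeff j (shiftRestrict (tau c (n + 1)) ^ 2)) =
      ∑ k ∈ Finset.range (i + 1), ∑ l ∈ Finset.range (j + 1),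
        restrict (schur scaledTS k (schur (-scaledTS) l (tau c (n + 1))))
          * restrict (schur scaledTS ((i : ℤ) - k)
              (schur (-scaledTS) ((j : ℤ) - l) (tau c (n + 1)))) := by
    rw [sq, PowerSeries.coeff_mul, map_sum, Finset.Nat.sum_antidiagonal_eq_sum_range_succ_mk,
      Finset.sum_comm]
    refine Finset.sum_congr rfl fun l hl => ?_
    rw [PowerSeries.coeff_mul, Finset.Nat.sum_antidiagonal_eq_sum_range_succ_mk]
    refine Finset.sum_congr rfl fun k hk => ?_
    have hk' : k ≤ i := Nat.lt_succ_iff.mp (Finset.mem_range.mp hk)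
    have hl' : l ≤ j := Nat.lt_succ_iff.mp (Finset.mem_range.mp hl)
    simp only [coeff_coeff_shiftRestrict, Nat.cast_sub hk', Nat.cast_sub hl']
  simp only [map_sub, map_add, hsq, hlhs, coeff_coeff_shiftDown_mul_shiftUp,
    PowerSeries.coeff_C_mul, coeff_coeff_shiftBoth, Nat.cast_zero, Nat.cast_one, Nat.cast_ofNat,
    sub_zero] at h
  rw [← h]
  ring

theorem schur_one {A : Type*} [Ring A] [Algebra ℂ A] (x : ℕ+ → A) : schur x 1 = x 1 := by
  change schur x (Int.ofNat 1) = x 1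
  simp [schur, Finset.sum_range_succ, PowerSeries.coeff_one]

/-- The case `i = j = 1` of `bilinear_relation`, simplified by `restrict_dTS_tau`. -/
theorem symTau_mul_restrict_dTS_dTS {c : Matrix ℕ ℕ ℂ} (hc : c.IsSymm) (n : ℕ) :
    symTau c (n + 1) * restrict (dTS 1 (dTS 1 (tau c (n + 1)))) =
      (1 / 2 : ℂ) • (symTau c (n + 1) * dT 1 (dT 1 (symTau c (n + 1)))) -
        ((1 / 4 : ℂ) • (dT 1 (symTau c (n + 1))) ^ 2 + symTau c n * symTau c (n + 2)) := by
  have h := bilinear_relation hc n 1 1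
  have hTS : scaledTS 1 = dTS 1 := by simp [scaledTS]
  have hT : scaledT 1 = dT 1 := by simp [scaledT]
  have hneg : ∀ f : MvPowerSeries TSVar ℂ, restrict (-f) = -restrict f := fun f => by
    simp only [← restrictHom_apply, map_neg]
  have hnegone : ∀ {A : Type} [Ring A] [Algebra ℂ A] (x : ℕ+ → A), schur x (-1) = 0 :=
    fun x => rfl
  have hself : restrict (tau c (n + 1)) = symTau c (n + 1) := rfl
  simp only [Finset.sum_range_succ, Finset.range_zero, Finset.sum_empty, zero_add, Nat.cast_zero,
    Nat.cast_one, sub_self, sub_zero, schur_zero, schur_one, Pi.neg_apply, hTS, hT,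
    Module.End.one_apply, LinearMap.neg_apply, hneg, map_neg, restrict_dTS_tau hc, hself,
    show (1 : ℤ) - 2 = -1 by norm_num, hnegone, LinearMap.zero_apply, mul_zero, zero_mul] at h
  have hhalf : MvPowerSeries.C (σ := ℕ+) (1 / 2 : ℂ) + MvPowerSeries.C (1 / 2 : ℂ) = 1 := by
    rw [← map_add]; norm_num
  have hquarter : MvPowerSeries.C (σ := ℕ+) (1 / 4 : ℂ) =
      MvPowerSeries.C (1 / 2 : ℂ) * MvPowerSeries.C (1 / 2 : ℂ) := by
    rw [← map_mul]; norm_num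
  simp only [MvPowerSeries.smul_eq_C_mul] at h ⊢
  rw [hquarter]
  generalize MvPowerSeries.C (σ := ℕ+) (1 / 2 : ℂ) = r at *
  generalize restrict (dTS 1 (dTS 1 (tau c (n + 1)))) = w at *
  generalize dT 1 (dT 1 (symTau c (n + 1))) = v at *
  generalize dT 1 (symTau c (n + 1)) = u at *
  generalize symTau c (n + 1) = f at *
  generalize symTau c (n + 2) = g at *
  linear_combination (-r) * h - (f * w + r ^ 2 * u ^ 2 + symTau c n * g) * hhalf

theorem restrict_dTS_dTS_tau {c : Matrix ℕ ℕ ℂ} (hc : c.IsSymm) {n : ℕ}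
    (hu : IsUnit (symTau c (n + 1))) :
    restrict (dTS 1 (dTS 1 (tau c (n + 1)))) =
      (1 / 2 : ℂ) • dT 1 (dT 1 (symTau c (n + 1)))
        - (symTau c (n + 1))⁻¹ * ((1 / 4 : ℂ) • (dT 1 (symTau c (n + 1))) ^ 2
            + symTau c n * symTau c (n + 2)) := by
  have hinv : (symTau c (n + 1))⁻¹ * symTau c (n + 1) = 1 :=
    MvPowerSeries.inv_mul_cancel _
      (isUnit_iff_ne_zero.mp (MvPowerSeries.isUnit_iff_constantCoeff.mp hu))
  have h := congrArg ((symTau c (n + 1))⁻¹ * ·) (symTau_mul_restrict_dTS_dTS hc n)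
  simp only [mul_sub, mul_smul_comm, ← mul_assoc, hinv, one_mul] at h
  rw [h]

end Bilinear

/-! ### Miwa shifts as Taylor series -/

section Miwa

/-- The variables of `ℂ⟦t, α, β⟧` in the order `β, α, t₁, t₂, …`. -/
def variableEquiv : TABVar ≃ Option (Option ℕ+) where
  toFun
    | .t k => some (some k)
    | .α => some none
    | .β => none
  invFun
    | some (some k) => .t k
    | some none => .α
    | none => .β
  left_inv v := by cases v <;> rfl
  right_inv v := by rcases v with _ | _ | k <;> rfl

/-- The embedding of `ℂ⟦t, α, β⟧` into `ℂ⟦t⟧⟦α⟧⟦β⟧`. -/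
def toIterated : MvPowerSeries TABVar ℂ →ₐ[ℂ] PowerSeries (PowerSeries (MvPowerSeries ℕ+ ℂ)) :=
  ((PowerSeries.mapAlgHom (MvPowerSeries.optionEquivLeft ℕ+ ℂ).toAlgHom).comp
    (MvPowerSeries.optionEquivLeft (Option ℕ+) ℂ).toAlgHom).comp
      (MvPowerSeries.rename variableEquiv)

theorem toIterated_apply (f : MvPowerSeries TABVar ℂ) :
    toIterated f = PowerSeries.mapAlgHom (MvPowerSeries.optionEquivLeft ℕ+ ℂ).toAlgHom
      (MvPowerSeries.optionEquivLeft (Option ℕ+) ℂ (MvPowerSeries.rename variableEquiv f)) :=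
  rfl

theorem coeff_toIterated (i j : ℕ) (d : ℕ+ →₀ ℕ) (f : MvPowerSeries TABVar ℂ) :
    MvPowerSeries.coeff d (PowerSeries.coeff i (PowerSeries.coeff j (toIterated f))) =
      MvPowerSeries.coeff ((d.optionElim i).optionElim j)
        (MvPowerSeries.rename variableEquiv f) := by
  rw [toIterated_apply, PowerSeries.mapAlgHom_apply, PowerSeries.coeff_map,
    ← MvPowerSeries.coeff_coeff_optionEquivLeft, ← MvPowerSeries.coeff_coeff_optionEquivLeft]
  rfl

theorem toIterated_injective : Function.Injective toIterated := by
  intro f g h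
  rw [toIterated_apply, toIterated_apply, PowerSeries.mapAlgHom_apply, PowerSeries.mapAlgHom_apply] at h
  refine (MvPowerSeries.renameEquiv ℂ variableEquiv).injective
    ((MvPowerSeries.optionEquivLeft (Option ℕ+) ℂ).injective (PowerSeries.ext fun n => ?_))
  have hn := congrArg (PowerSeries.coeff n) h
  rw [PowerSeries.coeff_map, PowerSeries.coeff_map] at hn
  exact (MvPowerSeries.optionEquivLeft ℕ+ ℂ).injective hn

theorem toIterated_times (k : ℕ+) :
    toIterated (times k) = PowerSeries.C (PowerSeries.C (MvPowerSeries.X k)) := by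
  rw [toIterated_apply, times, MvPowerSeries.rename_X]
  change PowerSeries.mapAlgHom _ (MvPowerSeries.optionEquivLeft (Option ℕ+) ℂ
    (MvPowerSeries.X (some (some k)))) = _
  simp [PowerSeries.mapAlgHom_apply]

theorem toIterated_varα : toIterated varα = PowerSeries.C PowerSeries.X := by
  rw [toIterated_apply, varα, MvPowerSeries.rename_X]
  change PowerSeries.mapAlgHom _ (MvPowerSeries.optionEquivLeft (Option ℕ+) ℂ
    (MvPowerSeries.X (some none))) = _
  simp [PowerSeries.mapAlgHom_apply]

theorem toIterated_varβ : toIterated varβ = PowerSeries.X := by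
  rw [toIterated_apply, varβ, MvPowerSeries.rename_X]
  change PowerSeries.mapAlgHom _ (MvPowerSeries.optionEquivLeft (Option ℕ+) ℂ
    (MvPowerSeries.X none)) = _
  simp [PowerSeries.mapAlgHom_apply]

theorem isFinitary_coeff_toIterated (i j : ℕ) (d : ℕ+ →₀ ℕ) :
    IsFinitary fun f => MvPowerSeries.coeff d
      (PowerSeries.coeff i (PowerSeries.coeff j (toIterated f))) := by
  simp only [coeff_toIterated, MvPowerSeries.rename_eq_subst]
  exact isFinitary_subst (MvPowerSeries.HasSubst.X_comp variableEquiv) _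

/-- A substitution into power series in `t, α, β` is determined by its values on the variables. -/
theorem toIterated_subst {σ : Type*} {a : σ → MvPowerSeries TABVar ℂ}
    (ha : MvPowerSeries.HasSubst a)
    (g : MvPowerSeries σ ℂ →ₐ[ℂ] PowerSeries (PowerSeries (MvPowerSeries ℕ+ ℂ)))
    (hg : ∀ i j d, IsFinitary fun f => MvPowerSeries.coeff d
      (PowerSeries.coeff i (PowerSeries.coeff j (g f))))
    (hX : ∀ v, toIterated (a v) = g (MvPowerSeries.X v)) (f : MvPowerSeries σ ℂ) :
    toIterated (MvPowerSeries.subst a f) = g f := by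
  have h : toIterated.comp (MvPowerSeries.substAlgHom ha) = g := by
    refine algHom_ext_of_isFinitary
      (l := fun (x : ℕ × ℕ × (ℕ+ →₀ ℕ)) F => MvPowerSeries.coeff x.2.2
        (PowerSeries.coeff x.1 (PowerSeries.coeff x.2.1 F))) ?_ ?_ ?_ ?_
    · intro F G hFG
      ext j i d
      exact hFG (i, j, d)
    · rintro ⟨i, j, d⟩
      simp only [AlgHom.comp_apply, MvPowerSeries.substAlgHom_apply]
      exact (isFinitary_coeff_toIterated i j d).comp (isFinitary_subst ha)
    · rintro ⟨i, j, d⟩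
      exact hg i j d
    · intro v
      rw [AlgHom.comp_apply, MvPowerSeries.substAlgHom_X, hX]
  rw [← h, AlgHom.comp_apply, MvPowerSeries.substAlgHom_apply]

/-- If the first derivatives of `v` are constants, then so are the coefficients of its Taylor
series. -/
theorem schurHom_of_const_deriv {R : Type*} [CommRing R] [Algebra ℂ R]
    {D : ℕ+ → Derivation ℂ R R} (hD : ∀ k l f, D k (D l f) = D l (D k f)) {v : R} {e : ℕ+ → ℂ}
    (hv : ∀ k, D k v = algebraMap ℂ R (e k)) :
    schurHom hD v = PowerSeries.C v + PowerSeries.X * PowerSeries.mk fun n =>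
      algebraMap ℂ R (((n + 1 : ℕ) : ℂ)⁻¹ * e n.succPNat) := by
  ext n
  cases n with
  | zero => simp [coeff_schurHom, schur_zero]
  | succ n =>
    have hn : ((n + 1 : ℕ) : ℂ) ≠ 0 := Nat.cast_ne_zero.mpr (Nat.succ_ne_zero n)
    have h := succ_smul_schur_scaled hD n v
    rw [Finset.sum_eq_single (0, n)] at h
    · rw [coeff_schurHom, map_add, PowerSeries.coeff_succ_X_mul, PowerSeries.coeff_mk,
        PowerSeries.coeff_C, if_neg (Nat.succ_ne_zero n), zero_add]
      refine smul_right_injective R hn ?_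
      beta_reduce
      rw [h, hv, Nat.cast_zero, schur_zero, Module.End.one_apply, Algebra.smul_def, ← map_mul,
        mul_inv_cancel_left₀ hn]
    · rintro ⟨a, b⟩ hp hne
      have ha : a ≠ 0 := by
        rintro rfl
        simp_all
      rw [hv, ← coeff_schurHom hD, AlgHom.commutes, PowerSeries.algebraMap_apply,
        PowerSeries.coeff_C, if_neg ha]
    · simp

theorem schurHom_of_deriv_eq_single {R : Type*} [CommRing R] [Algebra ℂ R]
    {D : ℕ+ → Derivation ℂ R R} (hD : ∀ k l f, D k (D l f) = D l (D k f)) {v : R} (k : ℕ+)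
    (e : ℂ) (hv : ∀ l, D l v = algebraMap ℂ R (if l = k then e else 0)) :
    schurHom hD v = PowerSeries.C v + (((k : ℕ) : ℂ)⁻¹ * e) • PowerSeries.X ^ (k : ℕ) := by
  rw [schurHom_of_const_deriv hD hv]
  congr 1
  ext n
  cases n with
  | zero => simp [PowerSeries.coeff_X_pow, k.ne_zero.symm]
  | succ n =>
    rw [PowerSeries.coeff_succ_X_mul, PowerSeries.coeff_mk, PowerSeries.coeff_smul,
      PowerSeries.coeff_X_pow]
    have hiff : n.succPNat = k ↔ n + 1 = (k : ℕ) := by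
      rw [← PNat.coe_inj]; rfl
    by_cases h : n + 1 = (k : ℕ)
    · simp [hiff.mpr h, h, Algebra.smul_def]
    · simp [hiff, h]

theorem schurHom_derivT_X (k : ℕ+) : schurHom derivT_comm (MvPowerSeries.X k) =
    PowerSeries.C (MvPowerSeries.X k) + ((k : ℕ) : ℂ)⁻¹ • PowerSeries.X ^ (k : ℕ) := by
  rw [schurHom_of_deriv_eq_single derivT_comm k 1, mul_one]
  intro l
  by_cases h : l = k
  · subst h; simp [derivT]
  · simp [derivT, h, MvPowerSeries.pderiv_X_of_ne (Ne.symm h)]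

theorem schurHom_neg_derivT_X (k : ℕ+) : schurHom neg_derivT_comm (MvPowerSeries.X k) =
    PowerSeries.C (MvPowerSeries.X k) - ((k : ℕ) : ℂ)⁻¹ • PowerSeries.X ^ (k : ℕ) := by
  rw [schurHom_of_deriv_eq_single neg_derivT_comm k (-1), mul_neg_one, neg_smul, sub_eq_add_neg]
  intro l
  by_cases h : l = k
  · subst h; simp [derivT]
  · simp [derivT, h, MvPowerSeries.pderiv_X_of_ne (Ne.symm h)]

theorem schurHom_derivTS_X_t (k : ℕ+) :
    schurHom derivTS_comm (MvPowerSeries.X (TSVar.t k)) =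
      PowerSeries.C (MvPowerSeries.X (TSVar.t k)) +
        ((k : ℕ) : ℂ)⁻¹ • PowerSeries.X ^ (k : ℕ) := by
  rw [schurHom_of_deriv_eq_single derivTS_comm k 1, mul_one]
  intro l
  by_cases h : l = k
  · subst h; simp [derivTS]
  · have hne : TSVar.t k ≠ TSVar.t l := fun h' => h (TSVar.t.inj h').symm
    simp [derivTS, h, MvPowerSeries.pderiv_X_of_ne hne]

theorem schurHom_neg_derivTS_X_t (k : ℕ+) :
    schurHom neg_derivTS_comm (MvPowerSeries.X (TSVar.t k)) =
      PowerSeries.C (MvPowerSeries.X (TSVar.t k)) -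
        ((k : ℕ) : ℂ)⁻¹ • PowerSeries.X ^ (k : ℕ) := by
  rw [schurHom_of_deriv_eq_single neg_derivTS_comm k (-1), mul_neg_one, neg_smul, sub_eq_add_neg]
  intro l
  by_cases h : l = k
  · subst h; simp [derivTS]
  · have hne : TSVar.t k ≠ TSVar.t l := fun h' => h (TSVar.t.inj h').symm
    simp [derivTS, h, MvPowerSeries.pderiv_X_of_ne hne]

theorem schurHom_derivTS_X_s (k : ℕ+) :
    schurHom derivTS_comm (MvPowerSeries.X (TSVar.s k)) =
      PowerSeries.C (MvPowerSeries.X (TSVar.s k)) := by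
  rw [schurHom_of_deriv_eq_single derivTS_comm k 0 fun l => by simp [derivTS], mul_zero, zero_smul,
    add_zero]

theorem schurHom_neg_derivTS_X_s (k : ℕ+) :
    schurHom neg_derivTS_comm (MvPowerSeries.X (TSVar.s k)) =
      PowerSeries.C (MvPowerSeries.X (TSVar.s k)) := by
  rw [schurHom_of_deriv_eq_single neg_derivTS_comm k 0 fun l => by simp [derivTS], mul_zero,
    zero_smul, add_zero]

theorem isFinitary_schur_scaledT (n : ℕ) (d : ℕ+ →₀ ℕ) :
    IsFinitary fun f => MvPowerSeries.coeff d (schur scaledT (n : ℤ) f) :=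
  isFinitary_schur_scaled derivT_comm (fun k d => isFinitary_pderiv k d) n d

theorem isFinitary_schur_neg_scaledT (n : ℕ) (d : ℕ+ →₀ ℕ) :
    IsFinitary fun f => MvPowerSeries.coeff d (schur (-scaledT) (n : ℤ) f) := by
  rw [← scaled_neg_derivT]
  refine isFinitary_schur_scaled neg_derivT_comm (fun k d => ?_) n d
  exact (isFinitary_pderiv k d).op₂ (isFinitary_const 0) (fun x _ => -x)

theorem isFinitary_schur_scaledTS (n : ℕ) (d : TSVar →₀ ℕ) :
    IsFinitary fun f => MvPowerSeries.coeff d (schur scaledTS (n : ℤ) f) :=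
  isFinitary_schur_scaled derivTS_comm (fun k d => isFinitary_pderiv (TSVar.t k) d) n d

theorem isFinitary_schur_neg_scaledTS (n : ℕ) (d : TSVar →₀ ℕ) :
    IsFinitary fun f => MvPowerSeries.coeff d (schur (-scaledTS) (n : ℤ) f) := by
  rw [← scaled_neg_derivTS]
  refine isFinitary_schur_scaled neg_derivTS_comm (fun k d => ?_) n d
  exact (isFinitary_pderiv (TSVar.t k) d).op₂ (isFinitary_const 0) (fun x _ => -x)

theorem C_smul {A : Type*} [CommRing A] [Algebra ℂ A] (z : ℂ) (a : A) :
    PowerSeries.C (z • a) = z • PowerSeries.C a :=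
  map_smul (constHom A) z a

theorem map_coe_smul {A B : Type*} [CommRing A] [Algebra ℂ A] [CommRing B] [Algebra ℂ B]
    (g : A →ₐ[ℂ] B) (z : ℂ) (F : PowerSeries A) :
    PowerSeries.map (g : A →+* B) (z • F) = z • PowerSeries.map (g : A →+* B) F :=
  map_smul (PowerSeries.mapAlgHom g) z F

theorem toIterated_miwa_varα (k : ℕ+) : toIterated (miwa varα k) =
    ((k : ℕ) : ℂ)⁻¹ • PowerSeries.C PowerSeries.X ^ (k : ℕ) := by
  rw [miwa, map_smul, map_pow, toIterated_varα]

theorem toIterated_miwa_varβ (k : ℕ+) : toIterated (miwa varβ k) =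
    ((k : ℕ) : ℂ)⁻¹ • PowerSeries.X ^ (k : ℕ) := by
  rw [miwa, map_smul, map_pow, toIterated_varβ]

theorem hasSubst_miwa_varα : MvPowerSeries.HasSubst (miwa varα) :=
  hasSubst_miwa (by simp [varα])

theorem hasSubst_miwa_varβ : MvPowerSeries.HasSubst (miwa varβ) :=
  hasSubst_miwa (by simp [varβ])

theorem toIterated_evalT_times (f : MvPowerSeries ℕ+ ℂ) :
    toIterated (evalT f times) = PowerSeries.C (PowerSeries.C f) := by
  refine toIterated_subst hasSubst_times ((constHom _).comp (constHom _)) (fun i j d => ?_)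
    (fun k => toIterated_times k) f
  by_cases hj : j = 0
  · by_cases hi : i = 0
    · simpa [hi, hj] using isFinitary_coeff d
    · simpa [hi, hj, PowerSeries.coeff_C] using isFinitary_const 0
  · simpa [hj, PowerSeries.coeff_C] using isFinitary_const 0

theorem toIterated_evalT_up (f : MvPowerSeries ℕ+ ℂ) :
    toIterated (evalT f (times + miwa varα)) = shiftUp f := by
  refine toIterated_subst (hasSubst_times.add hasSubst_miwa_varα) shiftUp (fun i j d => ?_)
    (fun k => ?_) f
  · simp only [coeff_coeff_shiftUp]
    split_ifs
    · exact isFinitary_schur_scaledT i d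
    · simpa using isFinitary_const 0
  · rw [Pi.add_apply, map_add, toIterated_times, toIterated_miwa_varα, shiftUp, AlgHom.comp_apply,
      schurHom_derivT_X, constHom_apply, map_add, C_smul, map_pow]

theorem toIterated_evalT_down (f : MvPowerSeries ℕ+ ℂ) :
    toIterated (evalT f (times - miwa varβ)) = shiftDown f := by
  refine toIterated_subst (hasSubst_sub hasSubst_times hasSubst_miwa_varβ) shiftDown
    (fun i j d => ?_) (fun k => ?_) f
  · simp only [coeff_coeff_shiftDown]
    split_ifs
    · exact isFinitary_schur_neg_scaledT j d
    · simpa using isFinitary_const 0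
  · rw [Pi.sub_apply, map_sub, toIterated_times, toIterated_miwa_varβ, shiftDown, AlgHom.comp_apply,
      schurHom_neg_derivT_X, map_sub, map_smul]
    simp [PowerSeries.mapAlgHom_apply]

theorem toIterated_evalT_both (f : MvPowerSeries ℕ+ ℂ) :
    toIterated (evalT f (times + miwa varα - miwa varβ)) = shiftBoth f := by
  refine toIterated_subst (hasSubst_sub (hasSubst_times.add hasSubst_miwa_varα) hasSubst_miwa_varβ)
    shiftBoth (fun i j d => ?_) (fun k => ?_) f
  · simp only [coeff_coeff_shiftBoth]
    exact (isFinitary_schur_scaledT i d).comp (isFinitary_schur_neg_scaledT j)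
  · rw [Pi.sub_apply, Pi.add_apply, map_sub, map_add, toIterated_times, toIterated_miwa_varα,
      toIterated_miwa_varβ, shiftBoth, AlgHom.comp_apply, schurHom_neg_derivT_X, map_sub, map_smul]
    simp [PowerSeries.mapAlgHom_apply, schurHom_derivT_X, C_smul]

theorem toIterated_evalTS (f : MvPowerSeries TSVar ℂ) :
    toIterated (evalTS f (times + miwa varα - miwa varβ) (-times)) = shiftRestrict f := by
  have hX : ∀ v, restrictHom (MvPowerSeries.X v) =
      timePoint MvPowerSeries.X (-MvPowerSeries.X) v :=
    MvPowerSeries.substAlgHom_X hasSubst_restrict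
  refine toIterated_subst (hasSubst_timePoint
    (hasSubst_sub (hasSubst_times.add hasSubst_miwa_varα) hasSubst_miwa_varβ)
    (hasSubst_neg hasSubst_times)) shiftRestrict (fun i j d => ?_) (fun v => ?_) f
  · simp only [coeff_coeff_shiftRestrict]
    exact ((isFinitary_restrict d).comp (isFinitary_schur_scaledTS i)).comp
      (isFinitary_schur_neg_scaledTS j)
  · rcases v with k | k
    · simp only [timePoint, Pi.sub_apply, Pi.add_apply, map_sub, map_add, toIterated_times,
        toIterated_miwa_varα, toIterated_miwa_varβ, shiftRestrict, AlgHom.comp_apply,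
        schurHom_neg_derivTS_X_t, map_smul]
      simp [PowerSeries.mapAlgHom_apply, schurHom_derivTS_X_t, hX, timePoint, C_smul,
        map_coe_smul]
    · simp only [timePoint, Pi.neg_apply, map_neg, toIterated_times, shiftRestrict,
        AlgHom.comp_apply, schurHom_neg_derivTS_X_s]
      simp [PowerSeries.mapAlgHom_apply, schurHom_derivTS_X_s, hX, timePoint]

/-- The relation between the symmetric and the 2d-Toda tau functions. -/
theorem evalT_symTau_relation {c : Matrix ℕ ℕ ℂ} (hc : c.IsSymm) (n : ℕ) :
    evalT (symTau c (n + 1)) times * evalT (symTau c (n + 1)) (times + miwa varα - miwa varβ)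
      - (varβ - varα) ^ 2 * evalT (symTau c n) (times - miwa varβ)
          * evalT (symTau c (n + 2)) (times + miwa varα)
      = evalTS (tau c (n + 1)) (times + miwa varα - miwa varβ) (-times) ^ 2 := by
  apply toIterated_injective
  simp only [map_sub, map_mul, map_pow, toIterated_evalT_times, toIterated_evalT_both,
    toIterated_evalT_down, toIterated_evalT_up, toIterated_evalTS, toIterated_varα, toIterated_varβ]
  exact generating_identity hc n

end Miwa

end TodaReduction

end

open TodaReduction in
theorem mainTheorem1 (c : Matrix ℕ ℕ ℂ) (hc : c.IsSymm) :
    -- the relation between the symmetric and the 2d-Toda tau functions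
    (∀ m : ℕ, 1 ≤ m →
      evalT (symTau c m) times * evalT (symTau c m) (times + miwa varα - miwa varβ)
        - (varβ - varα) ^ 2 * evalT (symTau c (m - 1)) (times - miwa varβ)
            * evalT (symTau c (m + 1)) (times + miwa varα)
        = evalTS (tau c m) (times + miwa varα - miwa varβ) (-times) ^ 2) ∧
    -- order zero
    (∀ m : ℕ, restrict (tau c m) = symTau c m) ∧
    -- first order
    (∀ (m : ℕ) (k : ℕ+),
      restrict (dTS k (tau c m)) = (1 / 2 : ℂ) • dT k (symTau c m)) ∧
    -- second order
    (∀ m : ℕ, 1 ≤ m → (Matrix.of fun i j : Fin m => c i j).det ≠ 0 →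
      IsUnit (symTau c m) ∧
      restrict (dTS 1 (dTS 1 (tau c m))) =
        (1 / 2 : ℂ) • dT 1 (dT 1 (symTau c m))
          - (symTau c m)⁻¹ * ((1 / 4 : ℂ) • (dT 1 (symTau c m)) ^ 2
              + symTau c (m - 1) * symTau c (m + 1))) ∧
    -- the general relation
    (∀ m i j : ℕ, 1 ≤ m →
      ∑ k ∈ Finset.range (i + 1), ∑ l ∈ Finset.range (j + 1),
          restrict (schur scaledTS k (schur (-scaledTS) l (tau c m)))
            * restrict (schur scaledTS ((i : ℤ) - k) (schur (-scaledTS) ((j : ℤ) - l) (tau c m)))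
        = symTau c m * schur scaledT i (schur (-scaledT) j (symTau c m))
          - schur (-scaledT) j (symTau c (m - 1)) * schur scaledT ((i : ℤ) - 2) (symTau c (m + 1))
          + 2 * (schur (-scaledT) ((j : ℤ) - 1) (symTau c (m - 1))
              * schur scaledT ((i : ℤ) - 1) (symTau c (m + 1)))
          - schur (-scaledT) ((j : ℤ) - 2) (symTau c (m - 1))
              * schur scaledT i (symTau c (m + 1))) := by
  refine ⟨fun m hm => ?_, fun m => rfl, fun m k => restrict_dTS_tau hc m k, fun m hm hdet => ?_,
    fun m i j hm => ?_⟩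
  all_goals obtain ⟨n, rfl⟩ : ∃ n, m = n + 1 := ⟨m - 1, by omega⟩
  · exact evalT_symTau_relation hc n
  · exact ⟨isUnit_symTau hdet, restrict_dTS_dTS_tau hc (isUnit_symTau hdet)⟩
  · exact bilinear_relation hc n i j
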